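/- Let $\mathcal K$ be a finite set of alternatives with $|\mathcal K|\ge 2$, $\mathcal C$ a finite nonempty set of contexts, and $F:\mathcal K\times\mathcal C\to\mathbb R$ a fixed (unknown) reward function such that for every $c\in\mathcal C$ the maximizer of $k\mapsto F(k,c)$ is unique. The $j$-th observation of a pair $(k,c)$ has the value $F(k,c)+\epsilon^j(k,c)$, where the $\epsilon^j(k,c)\sim\mathcal N(0,\sigma^2(k,c))$ are independent across $j,k,c$ and the variances $\sigma^2(k,c)>0$ are known. For each alternative $k$ the statistical model is a Gaussian process over $\mathcal C$ with a prior mean vector $\mu_0(k,\cdot)$ and a strictly positive definite prior covariance matrix $\Sigma_0(\cdot,\cdot;k)$, both fixed across iterations. After $n$ observations in total, let $D_n(k)$ be the list of the contexts at which $k$ was evaluated (with repetitions), $Y_n(k)$ the vector of the corresponding observations, $A_n(k)=\Sigma_0(D_n(k),D_n(k);k)+\mathrm{diag}(\sigma^2(k,D_n(k)))$, and let $$\mu_n(k,c)=\mu_0(k,c)+\Sigma_0(c,D_n(k);k)\,A_n(k)^{-1}\,(Y_n(k)-\mu_0(k,D_n(k))),$$ $$\Sigma_n(k,c)=\Sigma_0(c,c;k)-\Sigma_0(c,D_n(k);k)\,A_n(k)^{-1}\,\Sigma_0(D_n(k),c;k)$$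 be the posterior mean and variance. Let $N_n(k,c)$ be the number of observations of $(k,c)$ among the first $n$, and $\hat p(k,c)=N_n(k,c)/n$. The GP-C-OCBA policy takes $N_0\ge1$ initial observations at predetermined pairs. Then, for each $n\ge N_0$, it lets $\pi^n(c)\in\arg\max_k\mu_n(k,c)$ for each $c$ and $$\zeta(k,c)=\frac{(\mu_n(\pi^n(c),c)-\mu_n(k,c))^2}{\Sigma_n(\pi^n(c),c)+\Sigma_n(k,c)}\quad(k\ne\pi^n(c)),$$ $$\psi^{(1)}(c)=\frac{\hat p(\pi^n(c),c)}{\Sigma_n(\pi^n(c),c)},\qquad \psi^{(2)}(c)=\sum_{k\ne\pi^n(c)}\frac{\hat p(k,c)}{\Sigma_n(k,c)},$$ picks $(\tilde k,\tilde c)\in\arg\min_{c\in\mathcal C,\,k\neq\pi^n(c)}\zeta(k,c)$, and takes the next observation at $(\pi^n(\tilde c),\tilde c)$ if $\psi^{(1)}(\tilde c)<\psi^{(2)}(\tilde c)$, and at $(\tilde k,\tilde c)$ otherwise. Ties in the $\arg\max$ and $\arg\min$ are resolved by an arbitrary measurable function of the history of evaluated pairs and observations. Then, almost surely, $\lim_{n\to\infty}N_n(k,c)=\infty$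 for all $k\in\mathcal K$ and $c\in\mathcal C$. -/

import Mathlib

open MeasureTheory ProbabilityTheory Filter Topology
open scoped NNReal Matrix

namespace ContextualRS

/-- The statistical model: for every alternative `k` a Gaussian process prior over the finite set of
contexts, with mean vector `priorMean k` and covariance matrix `priorCov k`, and the known variance
`noiseVar k c` of the observation noise of the pair `(k, c)`. -/
structure GPModel (K C : Type*) where
  priorMean : K → C → ℝ
  priorCov : K → Matrix C C ℝ
  noiseVar : K → C → ℝ≥0

/-- The first `n` evaluated alternative–context pairs with the observed values. -/
structure History (K C : Type*) (n : ℕ) where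
  pair : Fin n → K × C
  obs : Fin n → ℝ

section Posterior

variable {K C : Type*} [DecidableEq K] {n : ℕ}

/-- The (indices of the) observations of alternative `k`. -/
abbrev History.Obs (h : History K C n) (k : K) : Type := {i : Fin n // (h.pair i).1 = k}

/-- `D_n(k)`: the contexts at which alternative `k` has been evaluated, with repetitions. -/
def History.ctx (h : History K C n) (k : K) (i : h.Obs k) : C := (h.pair i).2

/-- `N_n(k, c)`: the number of observations of the pair `p = (k, c)`. -/
def History.count [DecidableEq C] (h : History K C n) (p : K × C) : ℕ :=
  (Finset.univ.filter fun i => h.pair i = p).card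

/-- `A_n(k) = Σ₀(D_n(k), D_n(k); k) + diag(σ²(k, D_n(k)))`. -/
def GPModel.obsCov (M : GPModel K C) (h : History K C n) (k : K) :
    Matrix (h.Obs k) (h.Obs k) ℝ :=
  (M.priorCov k).submatrix (h.ctx k) (h.ctx k)
    + Matrix.diagonal fun i => (M.noiseVar k (h.ctx k i) : ℝ)

/-- The posterior mean
`μ_n(k, c) = μ₀(k, c) + Σ₀(c, D_n(k); k) A_n(k)⁻¹ (Y_n(k) - μ₀(k, D_n(k)))`. -/
noncomputable def GPModel.postMean (M : GPModel K C) (h : History K C n) (k : K) (c : C) : ℝ :=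
  M.priorMean k c + (fun i => M.priorCov k c (h.ctx k i)) ⬝ᵥ
    ((M.obsCov h k)⁻¹ *ᵥ fun i => h.obs i - M.priorMean k (h.ctx k i))

/-- The posterior covariance
`Σ_n(c, c'; k) = Σ₀(c, c'; k) - Σ₀(c, D_n(k); k) A_n(k)⁻¹ Σ₀(D_n(k), c'; k)`. -/
noncomputable def GPModel.postCov (M : GPModel K C) (h : History K C n) (k : K) (c c' : C) : ℝ :=
  M.priorCov k c c' - (fun i => M.priorCov k c (h.ctx k i)) ⬝ᵥ
    ((M.obsCov h k)⁻¹ *ᵥ fun i => M.priorCov k (h.ctx k i) c')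

/-- The posterior variance `Σ_n(k, c) = Σ_n(c, c; k)`. -/
noncomputable def GPModel.postVar (M : GPModel K C) (h : History K C n) (k : K) (c : C) : ℝ :=
  M.postCov h k c c

end Posterior

section Policy

variable {K C : Type*} [Fintype K] [DecidableEq K] [DecidableEq C] {n : ℕ}

/-- `p̂(k, c)`: the fraction of the observations so far that were allocated to `(k, c)`. -/
noncomputable def History.frac (h : History K C n) (p : K × C) : ℝ := (h.count p : ℝ) / n

/-- `ζ(k, c)`, for the predicted best alternatives `b`. -/
noncomputable def GPModel.zeta (M : GPModel K C) (h : History K C n) (b : C → K) (k : K) (c : C) :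
    ℝ :=
  (M.postMean h (b c) c - M.postMean h k c) ^ 2 / (M.postVar h (b c) c + M.postVar h k c)

/-- `ψ⁽¹⁾(c)`, for the predicted best alternatives `b`. -/
noncomputable def GPModel.psi₁ (M : GPModel K C) (h : History K C n) (b : C → K) (c : C) : ℝ :=
  h.frac (b c, c) / M.postVar h (b c) c

/-- `ψ⁽²⁾(c)`, for the predicted best alternatives `b`. -/
noncomputable def GPModel.psi₂ (M : GPModel K C) (h : History K C n) (b : C → K) (c : C) : ℝ :=
  ∑ k ∈ Finset.univ.filter (fun k => k ≠ b c), h.frac (k, c) / M.postVar h k c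

/-- `p` is the next pair to evaluate according to one GP-C-OCBA step after the history `h`, for some
way of resolving ties: `b c` maximizes the posterior mean in every context `c`, the pair `(k, c)`
minimizes `ζ` among all pairs with `k ≠ b c`, and `p` is `(b c, c)` if `ψ⁽¹⁾(c) < ψ⁽²⁾(c)` and
`(k, c)` otherwise. -/
def GPModel.IsGPCOCBAStep (M : GPModel K C) (h : History K C n) (p : K × C) : Prop :=
  ∃ b : C → K, (∀ c k, M.postMean h k c ≤ M.postMean h (b c) c) ∧
    ∃ (k : K) (c : C), k ≠ b c ∧
      (∀ k' c', k' ≠ b c' → M.zeta h b k c ≤ M.zeta h b k' c') ∧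
      ((M.psi₁ h b c < M.psi₂ h b c ∧ p = (b c, c)) ∨
        (¬ M.psi₁ h b c < M.psi₂ h b c ∧ p = (k, c)))

/-- A sampling policy: the next pair to evaluate as a function of the history. -/
abbrev Policy (K C : Type*) : Type _ := (n : ℕ) → History K C n → K × C

/-- `δ` is a GP-C-OCBA policy: the first `N₀ ≥ 1` pairs are the predetermined ones `init 0, …,
init (N₀ - 1)`, and every later pair is chosen by a GP-C-OCBA step. Ties may be resolved in any
way that depends measurably on the history. -/
structure IsGPCOCBA (M : GPModel K C) (N₀ : ℕ) (init : ℕ → K × C) (δ : Policy K C) : Prop where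
  pos : 0 < N₀
  initial : ∀ n < N₀, ∀ h : History K C n, δ n h = init n
  step : ∀ n, N₀ ≤ n → ∀ h : History K C n, M.IsGPCOCBAStep h (δ n h)
  meas : ∀ (n : ℕ) (a : Fin n → K × C) (p : K × C),
    MeasurableSet {y : Fin n → ℝ | δ n ⟨a, y⟩ = p}

/-- The history after `n` evaluations under the policy `δ`, when the `j`-th observation
(`j = 0, 1, …`) of the pair `(k, c)` has the value `F k c + e j k c`. -/
def run (δ : Policy K C) (F : K → C → ℝ) (e : ℕ → K → C → ℝ) : (n : ℕ) → History K C n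
  | 0 => ⟨Fin.elim0, Fin.elim0⟩
  | n + 1 =>
    let h := run δ F e n
    let p := δ n h
    ⟨Fin.snoc (α := fun _ => K × C) h.pair p,
      Fin.snoc (α := fun _ => ℝ) h.obs (F p.1 p.2 + e (h.count p) p.1 p.2)⟩

end Policy

end ContextualRS

namespace ContextualRS

/-! The argument is pathwise, by contradiction. Suppose that one pair `(k₀, c₀)` is observed only
boundedly often. Its posterior variance then stays away from zero while posterior means stay
bounded, so the minimum of `ζ` is at most some constant `B` at every step. It suffices to show that
all counts in every context are then bounded, since the counts add up to `n`.

Two deterministic facts describe the posterior (`GPModel.exists_postMean_bound`,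
`GPModel.exists_postVar_bound`): after `N` observations of a pair, its variance is of order `1 / (1
+ N)` and its mean differs from the sample average by `O(1 / N)`. Hence `ζ` is large when two counts
are of order `r` and the sample averages differ by a large multiple of `1 / √r`. Also, each ratio in
`ψ⁽¹⁾`, `ψ⁽²⁾` is of order `N ^ 2 / n`, so the comparison of `ψ⁽¹⁾` with `ψ⁽²⁾` keeps the evaluated
pair within a factor `A` of some rival in its context (`GPModel.IsGPCOCBAStep.exists_count_le`).

Unequal rewards separate sample averages by the law of large numbers. For equal rewards the noise
must do it: `ae_frequently_separated` gives, almost surely, arbitrarily large `r` such that the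
noise averages are separated by `D / √r` in a prescribed order, simultaneously for all sample sizes
in `[r, L * r]`. Uniformity over the sample sizes is needed because the counts are chosen
adaptively.

Fix such an `r`. While counts stay below `L * r`, the alternatives with at least `r` observations
have posterior means in a fixed strict order, and `ζ` between any two of them exceeds `B`. So, once
some count reaches `A * r`, an alternative with at least `r` observations is evaluated only as the
predicted best, which is then the top of that order. Together with the factor `A` this confines the
counts to `L * r`, by the induction in `counts_le_of_increments`. -/

theorem exists_pos_mul_sq_norm_le_dotProduct_mulVec {C : Type*} [Fintype C] {S : Matrix C C ℝ}
    (hS : S.PosDef) : ∃ l : ℝ, 0 < l ∧ ∀ x : C → ℝ, l * ‖x‖ ^ 2 ≤ x ⬝ᵥ (S *ᵥ x) := by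
  have hcont : Continuous fun x : C → ℝ => x ⬝ᵥ (S *ᵥ x) := by
    simp only [Matrix.mulVec, dotProduct]
    fun_prop
  have hpos : ∀ x : C → ℝ, x ≠ 0 → 0 < x ⬝ᵥ (S *ᵥ x) := fun x hx => by
    simpa using hS.dotProduct_mulVec_pos hx
  have hcpt : IsCompact (Metric.sphere (0 : C → ℝ) 1) := isCompact_sphere _ _
  -- The minimum over the compact unit sphere is the constant, by homogeneity. The sphere is empty
  -- only if `C` is.
  by_cases hne : (Metric.sphere (0 : C → ℝ) 1).Nonempty
  · obtain ⟨z, hz, hmin⟩ := hcpt.exists_isMinOn hne hcont.continuousOn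
    have hz1 : ‖z‖ = 1 := by simpa using hz
    refine ⟨z ⬝ᵥ (S *ᵥ z), hpos z (by rintro rfl; simp at hz1), fun x => ?_⟩
    by_cases hx : x = 0
    · simp [hx]
    have hxn : 0 < ‖x‖ := norm_pos_iff.2 hx
    have h1 : z ⬝ᵥ (S *ᵥ z) ≤ (‖x‖⁻¹ • x) ⬝ᵥ (S *ᵥ (‖x‖⁻¹ • x)) := by
      apply hmin
      simp [norm_smul, hxn.ne']
    rw [Matrix.mulVec_smul, smul_dotProduct, dotProduct_smul, smul_eq_mul, smul_eq_mul] at h1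
    calc _ ≤ (‖x‖⁻¹ * (‖x‖⁻¹ * (x ⬝ᵥ (S *ᵥ x)))) * ‖x‖ ^ 2 := by gcongr
      _ = _ := by field_simp
  · refine ⟨1, one_pos, fun x => ?_⟩
    by_cases hx : x = 0
    · simp [hx]
    · exact (hne ⟨‖x‖⁻¹ • x, by simp [norm_smul, hx]⟩).elim

theorem GPModel.obsCov_posDef {K C : Type*} {n : ℕ} {M : GPModel K C}
    (hnoise : ∀ k c, 0 < M.noiseVar k c) (hprior : ∀ k, (M.priorCov k).PosDef)
    (h : History K C n) (k : K) :
    (M.obsCov h k).PosDef :=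
  Matrix.PosDef.posSemidef_add ((hprior k).posSemidef.submatrix _)
    (Matrix.PosDef.diagonal fun i => by exact_mod_cast hnoise k (h.ctx k i))

/-! ### Posterior mean and variance in terms of counts -/

section Posterior

variable {K C : Type*} [DecidableEq K] {n : ℕ}

theorem History.card_obs_filter [DecidableEq C] (h : History K C n) (k : K) (c : C) :
    (Finset.univ.filter fun i : h.Obs k => h.ctx k i = c).card = h.count (k, c) := by
  unfold History.count
  refine Finset.card_bij (fun i _ => i.1) ?_ ?_ ?_
  · rintro ⟨i, hi⟩ hc
    exact Finset.mem_filter.2 ⟨Finset.mem_univ _, Prod.ext hi (Finset.mem_filter.1 hc).2⟩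
  · intro i _ j _ hij
    exact Subtype.ext hij
  · intro i hi
    simp only [Finset.mem_filter, Finset.mem_univ, true_and] at hi
    exact ⟨⟨i, by rw [hi]⟩, Finset.mem_filter.2 ⟨Finset.mem_univ _, congrArg Prod.snd hi⟩, rfl⟩

theorem History.sum_obs_filter [DecidableEq C] (h : History K C n) (k : K) (c : C)
    (f : Fin n → ℝ) :
    ∑ i ∈ Finset.univ.filter (fun i : h.Obs k => h.ctx k i = c), f i.1
      = ∑ i ∈ Finset.univ.filter (fun i => h.pair i = (k, c)), f i := by
  refine Finset.sum_bij (fun i _ => i.1) ?_ ?_ ?_ ?_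
  · rintro ⟨i, hi⟩ hc
    exact Finset.mem_filter.2 ⟨Finset.mem_univ _, Prod.ext hi (Finset.mem_filter.1 hc).2⟩
  · intro i _ j _ hij
    exact Subtype.ext hij
  · intro i hi
    simp only [Finset.mem_filter, Finset.mem_univ, true_and] at hi
    exact ⟨⟨i, by rw [hi]⟩, Finset.mem_filter.2 ⟨Finset.mem_univ _, congrArg Prod.snd hi⟩, rfl⟩
  · intro i _
    rfl

/-- The weights of the observations, aggregated over the contexts. -/
theorem GPModel.exists_weights [Fintype C] [DecidableEq C] {M : GPModel K C}
    (hnoise : ∀ k c, 0 < M.noiseVar k c) (hprior : ∀ k, (M.priorCov k).PosDef)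
    (h : History K C n) (k : K) (y : h.Obs k → ℝ) :
    ∃ w : C → ℝ,
      (∀ c, (fun i => M.priorCov k c (h.ctx k i)) ⬝ᵥ ((M.obsCov h k)⁻¹ *ᵥ y)
        = (M.priorCov k *ᵥ w) c) ∧
      ∀ c, (M.noiseVar k c : ℝ) * w c
        = ∑ i ∈ Finset.univ.filter (fun i => h.ctx k i = c), y i
          - h.count (k, c) * (M.priorCov k *ᵥ w) c := by
  set x := (M.obsCov h k)⁻¹ *ᵥ y with hx
  have hAx : M.obsCov h k *ᵥ x = y := by
    rw [hx, Matrix.mulVec_mulVec, Matrix.mul_nonsing_inv, Matrix.one_mulVec]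
    exact (Matrix.isUnit_iff_isUnit_det _).1 (M.obsCov_posDef hnoise hprior h k).isUnit
  -- Observations in the same context have the same prior covariances, so only the sum of their
  -- weights matters.
  have hagg : ∀ c, (fun i => M.priorCov k c (h.ctx k i)) ⬝ᵥ x
      = (M.priorCov k *ᵥ fun c' => ∑ i ∈ Finset.univ.filter (fun i => h.ctx k i = c'), x i) c := by
    intro c
    simp only [Matrix.mulVec, dotProduct]
    rw [← Finset.sum_fiberwise (s := Finset.univ) (g := fun i => h.ctx k i)]
    refine Finset.sum_congr rfl fun c' _ => ?_
    rw [Finset.mul_sum]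
    refine Finset.sum_congr rfl fun i hi => ?_
    rw [(Finset.mem_filter.1 hi).2]
  refine ⟨_, hagg, fun c => ?_⟩
  rw [← hagg c, ← h.card_obs_filter k c, Finset.mul_sum, ← nsmul_eq_mul, ← Finset.sum_const,
    ← Finset.sum_sub_distrib]
  refine Finset.sum_congr rfl fun i hi => ?_
  have hc := (Finset.mem_filter.1 hi).2
  -- Row `i` of `A x = y`; the second claim is the sum of these rows over the observations in
  -- context `c`.
  have := congrFun hAx i
  rw [GPModel.obsCov, Matrix.add_mulVec, Pi.add_apply, Matrix.mulVec_diagonal, hc] at this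
  rw [← this]
  have h2 : ((M.priorCov k).submatrix (h.ctx k) (h.ctx k) *ᵥ x) i
      = (fun i => M.priorCov k c (h.ctx k i)) ⬝ᵥ x := by
    simp [Matrix.mulVec, hc, Matrix.submatrix]
  rw [h2]
  ring

theorem mulVec_apply_abs_le {C : Type*} [Fintype C] (S : Matrix C C ℝ) (w : C → ℝ) (c : C) :
    |(S *ᵥ w) c| ≤ (∑ c', |S c c'|) * ‖w‖ := by
  rw [Matrix.mulVec, dotProduct, Finset.sum_mul]
  refine (Finset.abs_sum_le_sum_abs _ _).trans (Finset.sum_le_sum fun c' _ => ?_)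
  rw [abs_mul]
  gcongr
  exact norm_le_pi_norm w c'

/-- The sum of the observations of the pair `p`. -/
def History.obsSum [DecidableEq C] (h : History K C n) (p : K × C) : ℝ :=
  ∑ i ∈ Finset.univ.filter (fun i => h.pair i = p), h.obs i

/-- The posterior mean is bounded in terms of the sample averages, and differs from the sample
average of the same pair by at most a constant over the number of observations. -/
theorem GPModel.exists_postMean_bound [Fintype K] [Fintype C] [DecidableEq C] {M : GPModel K C}
    (hnoise : ∀ k c, 0 < M.noiseVar k c) (hprior : ∀ k, (M.priorCov k).PosDef) (R : ℝ) :
    ∃ D : ℝ, 0 < D ∧ ∀ (n : ℕ) (h : History K C n),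
      (∀ p, |h.obsSum p| ≤ R * h.count p) → ∀ k c,
        |M.postMean h k c| ≤ D ∧
        |h.count (k, c) * M.postMean h k c - h.obsSum (k, c)| ≤ D := by
  choose l hl0 hl using fun k => exists_pos_mul_sq_norm_le_dotProduct_mulVec (hprior k)
  -- `R'` bounds the averaged residuals in each context, and `W k` bounds the weights through `l *
  -- ‖w‖ ^ 2 ≤ card C * ‖w‖ * R'`.
  let R' : ℝ := |R| + ∑ k, ∑ c, |M.priorMean k c|
  let W : K → ℝ := fun k => Fintype.card C * R' / l k
  let D : K → C → ℝ := fun k c =>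
    |M.priorMean k c| + (∑ c', |M.priorCov k c c'|) * W k + M.noiseVar k c * W k
  have hR' : 0 ≤ R' := by positivity
  have hW : ∀ k, 0 ≤ W k := fun k => by have := hl0 k; positivity
  have hD : ∀ k c, 0 ≤ D k c := fun k c => by have := hW k; positivity
  have hDle : ∀ k c, D k c ≤ 1 + ∑ k, ∑ c, D k c := fun k c => by
    have h1 := Finset.single_le_sum (f := fun c => D k c) (fun c _ => hD k c) (Finset.mem_univ c)
    have h2 := Finset.single_le_sum (f := fun k => ∑ c, D k c)
      (fun k _ => Finset.sum_nonneg fun c _ => hD k c) (Finset.mem_univ k)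
    linarith
  have hRle : ∀ k c, |R| + |M.priorMean k c| ≤ R' := fun k c => by
    have h1 := Finset.single_le_sum (f := fun c => |M.priorMean k c|)
      (fun c _ => abs_nonneg _) (Finset.mem_univ c)
    have h2 := Finset.single_le_sum (f := fun k => ∑ c, |M.priorMean k c|)
      (fun k _ => Finset.sum_nonneg fun c _ => abs_nonneg _) (Finset.mem_univ k)
    simp only [R']
    linarith
  refine ⟨1 + ∑ k, ∑ c, D k c,
    add_pos_of_pos_of_nonneg one_pos
      (Finset.sum_nonneg fun k _ => Finset.sum_nonneg fun c _ => hD k c), fun n h hobs k c => ?_⟩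
  obtain ⟨w, hw1, hw2⟩ := M.exists_weights hnoise hprior h k
    (fun i => h.obs i - M.priorMean k (h.ctx k i))
  have hsum : ∀ c, ∑ i ∈ Finset.univ.filter (fun i => h.ctx k i = c),
      (h.obs i.1 - M.priorMean k (h.ctx k i))
      = h.obsSum (k, c) - h.count (k, c) * M.priorMean k c := by
    intro c
    rw [Finset.sum_sub_distrib, h.sum_obs_filter k c h.obs, ← h.card_obs_filter k c,
      ← nsmul_eq_mul, ← Finset.sum_const]
    congr 1
    refine Finset.sum_congr rfl fun i hi => ?_
    rw [(Finset.mem_filter.1 hi).2]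
  -- A bound uniform in the count `N`: `N * (Σ₀ w) c` is the residual sum, at most `R' * N`, minus
  -- `σ² * w c`, which contributes a nonpositive term after multiplication by `w c`.
  have hterm : ∀ c, w c * (M.priorCov k *ᵥ w) c ≤ ‖w‖ * R' := by
    intro c
    have hs : (0 : ℝ) < M.noiseVar k c := by exact_mod_cast hnoise k c
    have h2 := hw2 c
    rw [hsum] at h2
    rcases Nat.eq_zero_or_pos (h.count (k, c)) with h0 | h0
    · have ho := hobs (k, c)
      rw [h0] at h2 ho
      have : h.obsSum (k, c) = 0 := by
        rw [← abs_nonpos_iff]; simpa using ho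
      rw [this] at h2
      have hw0 : w c = 0 := by
        have : (M.noiseVar k c : ℝ) * w c = 0 := by rw [h2]; simp
        exact (mul_eq_zero.1 this).resolve_left hs.ne'
      rw [hw0, zero_mul]
      positivity
    · have hN : (0 : ℝ) < h.count (k, c) := by exact_mod_cast h0
      have hb : |h.obsSum (k, c) - h.count (k, c) * M.priorMean k c| ≤ R' * h.count (k, c) := by
        calc _ ≤ |h.obsSum (k, c)| + |h.count (k, c) * M.priorMean k c| := abs_sub _ _
          _ ≤ R * h.count (k, c) + h.count (k, c) * |M.priorMean k c| := by
            rw [abs_mul, Nat.abs_cast]; exact add_le_add (hobs _) le_rfl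
          _ ≤ |R| * h.count (k, c) + h.count (k, c) * |M.priorMean k c| := by
            gcongr; exact le_abs_self R
          _ = (|R| + |M.priorMean k c|) * h.count (k, c) := by ring
          _ ≤ _ := by gcongr; exact hRle k c
      refine le_of_mul_le_mul_left ?_ hN
      have h3 : h.count (k, c) * (w c * (M.priorCov k *ᵥ w) c)
          = w c * (h.obsSum (k, c) - h.count (k, c) * M.priorMean k c)
            - M.noiseVar k c * w c ^ 2 := by
        linear_combination w c * h2
      have h4 : w c * (h.obsSum (k, c) - h.count (k, c) * M.priorMean k c)
          ≤ ‖w‖ * (R' * h.count (k, c)) := by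
        calc _ ≤ |w c| * |h.obsSum (k, c) - h.count (k, c) * M.priorMean k c| := by
              rw [← abs_mul]; exact le_abs_self _
          _ ≤ _ := by gcongr; exact norm_le_pi_norm w c
      nlinarith [mul_nonneg hs.le (sq_nonneg (w c))]
  have hwn : ‖w‖ ≤ W k := by
    have h1 : l k * ‖w‖ ^ 2 ≤ Fintype.card C * (‖w‖ * R') := by
      refine (hl k w).trans ((Finset.sum_le_sum fun c _ => hterm c).trans ?_)
      simp
    rcases (norm_nonneg w).eq_or_lt with h0 | h0
    · rw [← h0]; exact hW k
    · rw [le_div_iff₀ (hl0 k)]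
      refine le_of_mul_le_mul_left ?_ h0
      linarith
  have hmean : M.postMean h k c = M.priorMean k c + (M.priorCov k *ᵥ w) c := by
    rw [GPModel.postMean, hw1]
  have hm := mulVec_apply_abs_le (M.priorCov k) w c
  have hm' : |(M.priorCov k *ᵥ w) c| ≤ (∑ c', |M.priorCov k c c'|) * W k :=
    hm.trans (by gcongr)
  have hnw : M.noiseVar k c * |w c| ≤ M.noiseVar k c * W k := by
    gcongr; exact (norm_le_pi_norm w c).trans hwn
  have hpos1 : 0 ≤ (M.noiseVar k c : ℝ) * W k := mul_nonneg (M.noiseVar k c).2 (hW k)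
  have hpos2 : 0 ≤ (∑ c', |M.priorCov k c c'|) * W k :=
    mul_nonneg (Finset.sum_nonneg fun c _ => abs_nonneg _) (hW k)
  constructor
  · refine le_trans ?_ (hDle k c)
    rw [hmean]
    refine (abs_add_le _ _).trans ?_
    simp only [D]
    linarith
  · refine le_trans ?_ (hDle k c)
    have h2 := hw2 c
    rw [hsum] at h2
    have h3 : h.count (k, c) * M.postMean h k c - h.obsSum (k, c) = -(M.noiseVar k c * w c) := by
      rw [hmean]; linear_combination h2
    rw [h3, abs_neg, abs_mul, abs_of_nonneg (M.noiseVar k c).coe_nonneg]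
    simp only [D]
    have := abs_nonneg (M.priorMean k c)
    linarith

/-- The posterior variance of a pair with `N` observations is of the order `1 / (1 + N)`. -/
theorem GPModel.exists_postVar_bound [Fintype C] [DecidableEq C] {M : GPModel K C}
    (hnoise : ∀ k c, 0 < M.noiseVar k c) (hprior : ∀ k, (M.priorCov k).PosDef) (k : K) :
    ∃ a : ℝ, 0 < a ∧ ∀ (n : ℕ) (h : History K C n) (c : C),
      a ≤ M.postVar h k c * (1 + h.count (k, c)) ∧
      M.postVar h k c * h.count (k, c) ≤ M.noiseVar k c := by
  obtain ⟨l, hl0, hl⟩ := exists_pos_mul_sq_norm_le_dotProduct_mulVec (hprior k)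
  have hex : ∃ s : ℝ, 0 < s ∧ ∀ c, s ≤ M.noiseVar k c := by
    rcases isEmpty_or_nonempty C with hC | hC
    · exact ⟨1, one_pos, fun c => hC.elim c⟩
    · obtain ⟨c, hc⟩ := Finite.exists_min fun c => (M.noiseVar k c : ℝ)
      exact ⟨M.noiseVar k c, by exact_mod_cast hnoise k c, hc⟩
  obtain ⟨s, hs0, hs⟩ := hex
  refine ⟨min (l / 4) (s / 2), by positivity, fun n h c => ?_⟩
  obtain ⟨w, hw1, hw2⟩ := M.exists_weights hnoise hprior h k
    (fun i => M.priorCov k (h.ctx k i) c)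
  have hsum : ∀ c', ∑ i ∈ Finset.univ.filter (fun i => h.ctx k i = c'),
      M.priorCov k (h.ctx k i) c = h.count (k, c') * M.priorCov k c' c := by
    intro c'
    rw [← h.card_obs_filter k c', ← nsmul_eq_mul, ← Finset.sum_const]
    refine Finset.sum_congr rfl fun i hi => ?_
    rw [(Finset.mem_filter.1 hi).2]
  -- With this `u`, `q = Σ₀ u` is the column at `c` of the posterior covariance.
  set u : C → ℝ := Pi.single c 1 - w with hu
  set q : C → ℝ := M.priorCov k *ᵥ u with hq
  have hq' : ∀ c', q c' = M.priorCov k c' c - (M.priorCov k *ᵥ w) c' := by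
    intro c'
    rw [hq, hu, Matrix.mulVec_sub]
    simp
  have hx : M.postVar h k c = q c := by
    rw [GPModel.postVar, GPModel.postCov, hw1, hq']
  have hwq : ∀ c', (M.noiseVar k c' : ℝ) * w c' = h.count (k, c') * q c' := by
    intro c'
    rw [hw2, hsum, hq']
    ring
  have hwq0 : ∀ c', (h.count (k, c') : ℝ) * q c' ^ 2 / M.noiseVar k c' = w c' * q c' := by
    intro c'
    have : (0 : ℝ) < M.noiseVar k c' := by exact_mod_cast hnoise k c'
    field_simp
    linear_combination (-q c') * hwq c'
  -- Since `w = N q / σ²` and `u + w` is the unit vector at `c`, the posterior variance `q c` splits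
  -- into nonnegative terms. Keeping those at `c` leaves `l * (1 - N x / σ²) ^ 2 + N x ^ 2 / σ² ≤
  -- x`, from which both bounds follow.
  have hquad : q c = u ⬝ᵥ q + ∑ c', (h.count (k, c') : ℝ) * q c' ^ 2 / M.noiseVar k c' := by
    simp_rw [hwq0]
    change _ = u ⬝ᵥ q + w ⬝ᵥ q
    rw [← add_dotProduct, hu, sub_add_cancel, single_dotProduct, one_mul]
  have hS0 : (0 : ℝ) < M.noiseVar k c := by exact_mod_cast hnoise k c
  have hge : l * (u c) ^ 2 + (h.count (k, c) : ℝ) * q c ^ 2 / M.noiseVar k c ≤ q c := by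
    have h1 : l * (u c) ^ 2 ≤ u ⬝ᵥ q := by
      refine le_trans ?_ (hl u)
      have : |u c| ≤ ‖u‖ := norm_le_pi_norm u c
      rw [← sq_abs]
      gcongr
    have h2 := Finset.single_le_sum (f := fun c' => (h.count (k, c') : ℝ) * q c' ^ 2 /
      M.noiseVar k c') (fun c' _ => by positivity) (Finset.mem_univ c)
    rw [hquad] at *
    linarith
  have huc : u c = 1 - h.count (k, c) * q c / M.noiseVar k c := by
    have := hwq c
    rw [hu]
    simp only [Pi.sub_apply, Pi.single_eq_same]
    field_simp
    linarith
  rw [hx]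
  generalize (h.count (k, c) : ℕ) = N at *
  have hsc := hs c
  generalize (M.noiseVar k c : ℝ) = σ at *
  generalize q c = x at *
  rw [huc] at hge
  have hN : (0 : ℝ) ≤ N := N.cast_nonneg
  have hxσ : (N : ℝ) * x ^ 2 / σ = x * (N * x / σ) := by ring
  have hx0 : 0 ≤ x := le_trans (by positivity) hge
  have hxpos : 0 < x := by
    refine hx0.lt_of_ne fun h0 => ?_
    rw [← h0] at hge
    simp at hge
    linarith
  have hup : N * x / σ ≤ 1 := by
    rw [hxσ] at hge
    refine le_of_mul_le_mul_left ?_ hxpos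
    nlinarith [mul_nonneg hl0.le (sq_nonneg (1 - N * x / σ))]
  constructor
  -- Either `1 - N x / σ` is at least `1 / 2`, and the first term forces `x ≥ l / 4`, or `N x`
  -- itself exceeds `σ / 2`.
  · by_cases hhalf : N * x / σ ≤ 1 / 2
    · have h1 : l / 4 ≤ x := by
        have : (1 / 2 : ℝ) ^ 2 ≤ (1 - N * x / σ) ^ 2 := by
          apply pow_le_pow_left₀ (by norm_num); linarith
        have h3 : 0 ≤ N * x ^ 2 / σ := by positivity
        nlinarith
      calc min (l / 4) (s / 2) ≤ x := (min_le_left _ _).trans h1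
        _ ≤ _ := by nlinarith [mul_nonneg hx0 hN]
    · push Not at hhalf
      rw [lt_div_iff₀ hS0] at hhalf
      calc min (l / 4) (s / 2) ≤ s / 2 := min_le_right _ _
        _ ≤ _ := by nlinarith
  · rw [div_le_one hS0] at hup
    linarith

end Posterior

/-! ### Independent blocks and sums of Gaussian variables -/

section Independence

variable {Ω : Type*} [mΩ : MeasurableSpace Ω] {P : Measure Ω}

/-- Split off one block at a time: the σ-algebra it generates is independent of the one generated by
the union of the others. -/
theorem measure_biInter_eq_prod_of_disjoint_blocks [IsProbabilityMeasure P] {ι J : Type*}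
    {m : ι → MeasurableSpace Ω} (hle : ∀ i, m i ≤ mΩ) (hm : iIndep m P) {T : J → Set ι}
    (hT : Pairwise fun i j => Disjoint (T i) (T j)) {E : J → Set Ω}
    (hE : ∀ j, MeasurableSet[⨆ i ∈ T j, m i] (E j)) (s : Finset J) :
    P (⋂ j ∈ s, E j) = ∏ j ∈ s, P (E j) := by
  classical
  induction s using Finset.induction_on with
  | empty => simp
  | insert a s ha ih =>
    rw [Finset.prod_insert ha, ← ih, Finset.set_biInter_insert]
    have hdisj : Disjoint (T a) (⋃ j ∈ s, T j) := by
      rw [Set.disjoint_iUnion₂_right]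
      intro j hj
      exact hT (fun h => ha (h ▸ hj))
    have hind := indep_iSup_of_disjoint hle hm hdisj
    refine (Indep_iff _ _ P).1 hind _ _ (hE a) ?_
    refine Finset.measurableSet_biInter _ fun j hj => ?_
    refine (iSup₂_le fun i hi => ?_ : (⨆ i ∈ T j, m i) ≤ ⨆ i ∈ ⋃ j ∈ s, T j, m i) _ (hE j)
    exact le_iSup₂_of_le i (Set.mem_iUnion₂.2 ⟨j, hj, hi⟩) le_rfl

theorem measurable_finsetSum_apply {ι : Type*} {X : ι → Ω → ℝ} (hm : ∀ i, Measurable (X i))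
    (s : Finset ι) : Measurable (∑ i ∈ s, X i) := by
  have : ∑ i ∈ s, X i = fun ω => ∑ i ∈ s, X i ω := by ext ω; simp
  rw [this]
  exact Finset.measurable_sum _ fun i _ => hm i

theorem hasLaw_sum_gaussianReal {ι : Type*} {X : ι → Ω → ℝ} {v : ℝ≥0}
    [IsProbabilityMeasure P] (hm : ∀ i, Measurable (X i)) (hindep : iIndepFun X P)
    (s : Finset ι) (hlaw : ∀ i ∈ s, HasLaw (X i) (gaussianReal 0 v) P) :
    HasLaw (∑ i ∈ s, X i) (gaussianReal 0 (s.card * v)) P := by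
  classical
  induction s using Finset.induction_on with
  | empty =>
    refine ⟨(measurable_const (a := (0 : ℝ))).aemeasurable, ?_⟩
    simp only [Finset.sum_empty, Finset.card_empty, Nat.cast_zero, zero_mul,
      gaussianReal_zero_var]
    change P.map (fun _ => (0 : ℝ)) = _
    simp [Measure.map_const]
  | insert a s ha ih =>
    have ih' := ih fun i hi => hlaw i (Finset.mem_insert_of_mem hi)
    refine ⟨(measurable_finsetSum_apply hm _).aemeasurable, ?_⟩
    rw [Finset.sum_insert ha, Finset.card_insert_of_notMem ha]
    have hi := (hindep.indepFun_finsetSum_of_notMem hm ha).symm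
    have := gaussianReal_add_gaussianReal_of_indepFun hi
      (hlaw a (Finset.mem_insert_self a s)).map_eq ih'.map_eq
    rw [this]
    congr 1
    · simp
    · push_cast; ring

/-- Integrate `|x| ≤ x ^ 2 / (2 * √V) + √V / 2`. -/
theorem integral_abs_le_sqrt_of_hasLaw_gaussianReal {T : Ω → ℝ} {V : ℝ≥0}
    [IsProbabilityMeasure P] (hV : 0 < V) (hT : HasLaw T (gaussianReal 0 V) P) :
    ∫ ω, |T ω| ∂P ≤ √(V : ℝ) := by
  have h1 : ∫ ω, |T ω| ∂P = ∫ x, |x| ∂gaussianReal 0 V := by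
    have := hT.integral_comp (f := fun x : ℝ => |x|) continuous_abs.aestronglyMeasurable
    exact this
  have h2 : ∫ x, x ^ 2 ∂gaussianReal 0 V = V := by
    have := variance_fun_id_gaussianReal (μ := 0) (v := V)
    rw [variance_of_integral_eq_zero (by fun_prop) (by simp)] at this
    simpa using this
  have hsq : Integrable (fun x : ℝ => x ^ 2) (gaussianReal 0 V) :=
    (memLp_id_gaussianReal (μ := 0) (v := V) 2).integrable_sq
  have hs : 0 < √(V : ℝ) := Real.sqrt_pos.2 (by exact_mod_cast hV)
  have hss : √(V : ℝ) * √(V : ℝ) = V := Real.mul_self_sqrt V.2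
  rw [h1]
  calc ∫ x, |x| ∂gaussianReal 0 V
      ≤ ∫ x, (x ^ 2 / (2 * √(V : ℝ)) + √(V : ℝ) / 2) ∂gaussianReal 0 V := by
        refine integral_mono_of_nonneg (Eventually.of_forall fun x => abs_nonneg x)
          ((hsq.div_const _).add (integrable_const _)) (Eventually.of_forall fun x => ?_)
        have hsq := sq_nonneg (|x| - √(V : ℝ))
        have : x ^ 2 / (2 * √(V : ℝ)) + √(V : ℝ) / 2 - |x|
            = (|x| - √(V : ℝ)) ^ 2 / (2 * √(V : ℝ)) := by
          rw [← sq_abs x]; field_simp; ring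
        have h3 : 0 ≤ (|x| - √(V : ℝ)) ^ 2 / (2 * √(V : ℝ)) := by positivity
        simp only
        linarith
    _ = √(V : ℝ) := by
        rw [integral_add (hsq.div_const _) (integrable_const _), integral_div, h2]
        have : (V : ℝ) / (2 * √(V : ℝ)) = √(V : ℝ) / 2 := by
          rw [div_eq_div_iff (by positivity) two_ne_zero]
          linear_combination (-2) * hss
        rw [this]
        simp

/-- Doob's maximal inequality for the absolute value of the martingale of partial sums, with its
first moment bounded by the standard deviation. -/
theorem measure_exists_lt_abs_sum_le [IsProbabilityMeasure P] {Y : ℕ → Ω → ℝ} {v : ℝ≥0}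
    (hv : 0 < v) (hm : ∀ i, Measurable (Y i)) (hindep : iIndepFun Y P)
    (hlaw : ∀ i, HasLaw (Y i) (gaussianReal 0 v) P) (m : ℕ) {t : ℝ} (ht : 0 < t) :
    P {ω | ∃ n ≤ m, t < |∑ i ∈ Finset.range n, Y i ω|} ≤ ENNReal.ofReal (√(m * v) / t) := by
  rcases m with _ | m
  · have : {ω | ∃ n ≤ 0, t < |∑ i ∈ Finset.range n, Y i ω|} = ∅ := by
      ext ω
      simp [ht.le]
    rw [this]
    simp
  have hsm : ∀ i, StronglyMeasurable (Y i) := fun i => (hm i).stronglyMeasurable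
  have hint : ∀ i, Integrable (Y i) P := fun i => by
    have := (memLp_id_gaussianReal (μ := 0) (v := v) 1).integrable le_rfl
    rw [← (hlaw i).map_eq] at this
    exact this.comp_aemeasurable (hm i).aemeasurable
  have hmean : ∀ i, P[Y i] = 0 := fun i => by
    rw [(hlaw i).integral_eq, integral_id_gaussianReal]
  let T : ℕ → Ω → ℝ := fun n => ∑ i ∈ Finset.range (n + 1), Y i
  have hTint : ∀ n, Integrable (T n) P := fun n => integrable_finsetSum' _ fun i _ => hint i
  let 𝒢 := Filtration.natural Y hsm
  have hTadp : StronglyAdapted 𝒢 T := fun n => by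
    refine Finset.stronglyMeasurable_sum _ fun i hi => ?_
    exact (Filtration.stronglyAdapted_natural hsm i).mono
      (𝒢.mono (Nat.lt_succ_iff.1 (Finset.mem_range.1 hi)))
  have hmart : Martingale T 𝒢 P := by
    refine martingale_nat hTadp hTint fun n => ?_
    have h1 : T (n + 1) = T n + Y (n + 1) := Finset.sum_range_succ _ _
    rw [h1]
    have h2 := condExp_add (hTint n) (hint (n + 1)) (𝒢 n)
    have h3 := hindep.condExp_natural_ae_eq_of_lt hsm (Nat.lt_succ_self n)
    have h4 := condExp_of_stronglyMeasurable (𝒢.le n) (hTadp n) (hTint n)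
    rw [h4] at h2
    filter_upwards [h2, h3] with ω hω2 hω3
    rw [hω2, Pi.add_apply, hω3, hmean, add_zero]
  have hsub : Submartingale (T ⊔ -T) 𝒢 P := hmart.submartingale.sup hmart.neg.submartingale
  have habs : ∀ n ω, (T ⊔ -T) n ω = |T n ω| := fun n ω => rfl
  have hnn : (0 : ℕ → Ω → ℝ) ≤ T ⊔ -T := fun n ω => by
    rw [habs]; exact abs_nonneg _
  have hmax := maximal_ineq hsub hnn (ε := ⟨t, ht.le⟩) m
  have hlawT : HasLaw (T m) (gaussianReal 0 ((m + 1 : ℕ) * v)) P := by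
    simpa using hasLaw_sum_gaussianReal hm hindep (Finset.range (m + 1)) fun i _ => hlaw i
  have hI := integral_abs_le_sqrt_of_hasLaw_gaussianReal (P := P)
    (V := (m + 1 : ℕ) * v) (by positivity) hlawT
  set S : Set Ω := {ω | ((⟨t, ht.le⟩ : ℝ≥0) : ℝ) ≤ (Finset.range (m + 1)).sup'
    Finset.nonempty_range_add_one fun k => (T ⊔ -T) k ω} with hS
  have hsubset : {ω | ∃ n ≤ m + 1, t < |∑ i ∈ Finset.range n, Y i ω|} ⊆ S := by
    rintro ω ⟨n, hn, hlt⟩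
    rcases n with _ | n
    · simp at hlt; exact absurd hlt ht.not_gt
    · refine le_trans ?_ (Finset.le_sup' (fun k => (T ⊔ -T) k ω)
        (Finset.mem_range.2 (by omega : n < m + 1)))
      rw [habs]
      simp only [T, Finset.sum_apply]
      exact hlt.le
  have hbound : ∫ ω in S, (T ⊔ -T) m ω ∂P ≤ √((m + 1 : ℕ) * v) := by
    refine le_trans ?_ (hI.trans (by push_cast; rfl))
    exact setIntegral_le_integral (hTint m).abs (Eventually.of_forall fun ω => abs_nonneg _)
  calc _ ≤ P S := measure_mono hsubset
    _ ≤ ENNReal.ofReal (√((m + 1 : ℕ) * v)) / ENNReal.ofReal t := by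
      rw [ENNReal.le_div_iff_mul_le (Or.inl (by simpa using ht)) (Or.inl ENNReal.ofReal_ne_top),
        mul_comm]
      refine le_trans ?_ (ENNReal.ofReal_le_ofReal hbound)
      have : ENNReal.ofReal t = ENNReal.ofNNReal ⟨t, ht.le⟩ :=
        congrArg ENNReal.ofNNReal (Real.toNNReal_of_nonneg ht.le)
      rw [this]
      exact hmax
    _ = _ := (ENNReal.ofReal_div_of_pos ht).symm

theorem gaussianReal_Icc_pos {v : ℝ≥0} (hv : 0 < v) {a b : ℝ} (hab : a < b) :
    0 < gaussianReal 0 v (Set.Icc a b) := by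
  rw [pos_iff_ne_zero]
  intro h0
  have := gaussianReal_absolutelyContinuous' 0 hv.ne' h0
  rw [Real.volume_Icc, ENNReal.ofReal_eq_zero] at this
  linarith

/-- A sum of `s.card` terms is distributed as `√s.card` times one term, so the lower bound does not
depend on the number of terms. -/
theorem gaussianReal_Icc_le_measure_sum_mem [IsProbabilityMeasure P] {ι : Type*} {X : ι → Ω → ℝ}
    {v : ℝ≥0} (hm : ∀ i, Measurable (X i)) (hindep : iIndepFun X P)
    (s : Finset ι) (hlaw : ∀ i ∈ s, HasLaw (X i) (gaussianReal 0 v) P) (a b : ℝ) :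
    gaussianReal 0 v (Set.Icc a b)
      ≤ P {ω | a * √(s.card : ℝ) ≤ ∑ i ∈ s, X i ω ∧ ∑ i ∈ s, X i ω ≤ b * √(s.card : ℝ)} := by
  have hS := hasLaw_sum_gaussianReal hm hindep s hlaw
  have h1 : {ω | a * √(s.card : ℝ) ≤ ∑ i ∈ s, X i ω ∧ ∑ i ∈ s, X i ω ≤ b * √(s.card : ℝ)}
      = (∑ i ∈ s, X i) ⁻¹' Set.Icc (a * √(s.card : ℝ)) (b * √(s.card : ℝ)) := by
    ext ω; simp
  rw [h1, ← Measure.map_apply (measurable_finsetSum_apply hm _) measurableSet_Icc,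
    hS.map_eq]
  have h2 : gaussianReal 0 (s.card * v) = (gaussianReal 0 v).map (√(s.card : ℝ) * ·) := by
    rw [gaussianReal_map_const_mul]
    congr 1
    · simp
    · ext; simp
  rw [h2, Measure.map_apply (by fun_prop) measurableSet_Icc]
  refine measure_mono fun x hx => ?_
  have hs := Real.sqrt_nonneg (s.card : ℝ)
  simp only [Set.mem_preimage, Set.mem_Icc] at hx ⊢
  constructor <;> nlinarith [hx.1, hx.2]

end Independence

/-! ### Separation of the noise averages in infinitely many windows -/

section Windows

variable {Ω : Type*} [mΩ : MeasurableSpace Ω] {P : Measure Ω} {Q : Type*} [Fintype Q]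

/-- In each of a sequence of disjoint windows of indices, the noise sums of all sequences have
prescribed sizes with a probability that is bounded below; so this happens infinitely often. -/
theorem ae_frequently_window [IsProbabilityMeasure P] {X : ℕ → Q → Ω → ℝ} {v : Q → ℝ≥0}
    (hv : ∀ p, 0 < v p) (hm : ∀ i p, Measurable (X i p))
    (hindep : iIndepFun (fun x : ℕ × Q => X x.1 x.2) P)
    (hlaw : ∀ i p, HasLaw (X i p) (gaussianReal 0 (v p)) P)
    (A : Q → ℝ) (L : ℕ) {κ : ℝ} (hκ0 : 0 < κ) (hκ : ∀ p, 2 * √(2 * L * v p) ≤ κ)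
    (q s : ℕ → ℕ) (hs : ∀ m, 0 < s m) (hqs : ∀ m, q m ≤ s m)
    (hq : ∀ m, L * (q m + s m) ≤ q (m + 1)) (hL : 1 ≤ L) :
    ∀ᵐ ω ∂P, ∃ᶠ m in atTop, ∀ p,
      (A p * √(s m) ≤ ∑ i ∈ Finset.Ico (q m) (q m + s m), X i p ω ∧
        ∑ i ∈ Finset.Ico (q m) (q m + s m), X i p ω ≤ (A p + 1) * √(s m)) ∧
      ∀ N ∈ Finset.Icc (q m + s m) (L * (q m + s m)),
        |∑ i ∈ Finset.Ico (q m + s m) N, X i p ω| ≤ κ * √(s m) := by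
  classical
  -- `false` labels the block of length `s m` that pushes the sum to the prescribed size, `true` the
  -- rest of the window, where the sum must not move much. All these index sets are disjoint.
  let T : ℕ × Q × Bool → Set (ℕ × Q) := fun x =>
    if x.2.2 then {y | y.2 = x.2.1 ∧ q x.1 + s x.1 ≤ y.1 ∧ y.1 < L * (q x.1 + s x.1)}
    else {y | y.2 = x.2.1 ∧ q x.1 ≤ y.1 ∧ y.1 < q x.1 + s x.1}
  let E : ℕ × Q × Bool → Set Ω := fun x =>
    if x.2.2 then {ω | ∀ N ∈ Finset.Icc (q x.1 + s x.1) (L * (q x.1 + s x.1)),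
      |∑ i ∈ Finset.Ico (q x.1 + s x.1) N, X i x.2.1 ω| ≤ κ * √(s x.1)}
    else {ω | A x.2.1 * √(s x.1) ≤ ∑ i ∈ Finset.Ico (q x.1) (q x.1 + s x.1), X i x.2.1 ω ∧
      ∑ i ∈ Finset.Ico (q x.1) (q x.1 + s x.1), X i x.2.1 ω ≤ (A x.2.1 + 1) * √(s x.1)}
  have hqmono : Monotone q := monotone_nat_of_le_succ fun m => by
    have := hq m
    nlinarith [hs m]
  have hTm : ∀ x y, y ∈ T x → y.2 = x.2.1 ∧ q x.1 ≤ y.1 ∧ y.1 < q (x.1 + 1) := by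
    rintro ⟨m, p, β⟩ y hy
    have h1 := hq m
    have h2 : q m + s m ≤ L * (q m + s m) := Nat.le_mul_of_pos_left _ hL
    cases β <;> simp only [T, Bool.false_eq_true, if_false, if_true, Set.mem_ofPred_eq] at hy ⊢
    · exact ⟨hy.1, hy.2.1, by omega⟩
    · exact ⟨hy.1, by omega, by omega⟩
  have hTdisj : Pairwise fun x y => Disjoint (T x) (T y) := by
    intro x y hxy
    rw [Set.disjoint_left]
    intro z hzx hzy
    have h1 := hTm x z hzx
    have h2 := hTm y z hzy
    have hm1 : x.1 = y.1 := by
      rcases lt_trichotomy x.1 y.1 with h | h | h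
      · have := hqmono (Nat.succ_le_of_lt h); simp only [Nat.succ_eq_add_one] at this; omega
      · exact h
      · have := hqmono (Nat.succ_le_of_lt h); simp only [Nat.succ_eq_add_one] at this; omega
    have hp1 : x.2.1 = y.2.1 := h1.1.symm.trans h2.1
    obtain ⟨m, p, β⟩ := x
    obtain ⟨m', p', β'⟩ := y
    simp only at hm1 hp1
    subst hm1 hp1
    cases β <;> cases β' <;>
      simp only [T, Bool.false_eq_true, if_false, if_true, Set.mem_ofPred_eq] at hzx hzy
    · exact hxy rfl
    · omega
    · omega
    · exact hxy rfl
  have hle : ∀ x : ℕ × Q, MeasurableSpace.comap (X x.1 x.2) inferInstance ≤ mΩ :=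
    fun x => (hm x.1 x.2).comap_le
  have hsum : ∀ (x : ℕ × Q × Bool) (F : Finset ℕ), (∀ i ∈ F, (i, x.2.1) ∈ T x) →
      Measurable[⨆ y ∈ T x, MeasurableSpace.comap (X y.1 y.2) inferInstance]
        fun ω => ∑ i ∈ F, X i x.2.1 ω := by
    intro x F hF
    refine Finset.measurable_sum _ fun i hi => ?_
    exact (comap_measurable (X i x.2.1)).mono
      (le_iSup₂_of_le (f := fun (y : ℕ × Q) (_ : y ∈ T x) =>
        MeasurableSpace.comap (X y.1 y.2) inferInstance) (i, x.2.1) (hF i hi) le_rfl) le_rfl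
  have hE : ∀ x, MeasurableSet[⨆ y ∈ T x, MeasurableSpace.comap (X y.1 y.2) inferInstance]
      (E x) := by
    rintro ⟨m, p, β⟩
    cases β
    · have := hsum (m, p, false) (Finset.Ico (q m) (q m + s m)) (fun i hi => by
        simpa [T] using hi)
      exact this (measurableSet_Icc (a := A p * √(s m)) (b := (A p + 1) * √(s m)))
    · have : E (m, p, true) = ⋂ N ∈ Finset.Icc (q m + s m) (L * (q m + s m)),
          (fun ω => ∑ i ∈ Finset.Ico (q m + s m) N, X i p ω) ⁻¹'
            {z | |z| ≤ κ * √(s m)} := by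
        ext ω
        simp [E]
      rw [this]
      refine Finset.measurableSet_biInter _ fun N hN => ?_
      refine hsum (m, p, true) (Finset.Ico (q m + s m) N) (fun i hi => ?_)
        (measurableSet_le continuous_abs.measurable measurable_const)
      simp only [Finset.mem_Ico, Finset.mem_Icc] at hi hN
      simp only [T, if_true, Set.mem_ofPred_eq, true_and]
      omega
  have hEm : ∀ x, MeasurableSet (E x) := fun x => (iSup₂_le fun y _ => hle y) _ (hE x)
  have hprod := measure_biInter_eq_prod_of_disjoint_blocks hle hindep hTdisj hE
  let G : ℕ → Set Ω := fun m => ⋂ y ∈ (Finset.univ : Finset (Q × Bool)), E (m, y)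
  have hGm : ∀ m, MeasurableSet (G m) := fun m =>
    Finset.measurableSet_biInter _ fun y _ => hEm _
  have hGP : ∀ m, P (G m) = ∏ y : Q × Bool, P (E (m, y)) := fun m => by
    have := hprod ({m} ×ˢ Finset.univ)
    rw [Finset.prod_product, Finset.prod_singleton] at this
    rw [← this]
    congr 1
    ext ω
    simp only [G, Set.mem_iInter, Finset.mem_product, Finset.mem_singleton, Finset.mem_univ,
      and_true, true_imp_iff]
    refine ⟨fun h x hx => ?_, fun h y => h (m, y) rfl⟩
    rw [← Prod.eta x, hx]
    exact h x.2
  have hGind : iIndepSet G P := by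
    rw [iIndepSet_iff_meas_biInter hGm]
    intro S
    have := hprod (S ×ˢ Finset.univ)
    rw [Finset.prod_product] at this
    simp_rw [hGP]
    rw [← this]
    congr 1
    ext ω
    simp only [G, Set.mem_iInter, Finset.mem_product, Finset.mem_univ, and_true, true_imp_iff]
    exact ⟨fun h x hx => h x.1 hx x.2, fun h m hm y => h (m, y) hm⟩
  -- A lower bound independent of `m`: the Gaussian probability serves the blocks, `1 / 2` the
  -- fluctuations after them. The second Borel–Cantelli lemma then applies.
  let b : ENNReal := ∏ y : Q × Bool,
    min (gaussianReal 0 (v y.1) (Set.Icc (A y.1) (A y.1 + 1))) (1 / 2)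
  have hb : b ≠ 0 := by
    rw [Finset.prod_ne_zero_iff]
    intro y _
    have := gaussianReal_Icc_pos (hv y.1) (lt_add_one (A y.1))
    exact (lt_min this (by simp)).ne'
  have hlow : ∀ m, b ≤ P (G m) := by
    intro m
    rw [hGP]
    refine Finset.prod_le_prod' fun y _ => ?_
    obtain ⟨p, β⟩ := y
    have hinj : Function.Injective fun i : ℕ => (i, p) := fun a b h => by simpa using h
    cases β
    · refine (min_le_left _ _).trans ?_
      have := gaussianReal_Icc_le_measure_sum_mem (fun i => hm i p) (hindep.precomp hinj)
        (Finset.Ico (q m) (q m + s m)) (fun i _ => hlaw i p) (A p) (A p + 1)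
      simpa [E] using this
    · refine (min_le_right _ _).trans ?_
      have hinj' : Function.Injective fun i : ℕ => (q m + s m + i, p) := fun a b h => by
        simpa using h
      have hsm : (0 : ℝ) < s m := by exact_mod_cast hs m
      have hsq : 0 < √(s m : ℝ) := Real.sqrt_pos.2 hsm
      have hmax := measure_exists_lt_abs_sum_le (hv p) (fun i => hm (q m + s m + i) p)
        (hindep.precomp hinj') (fun i => hlaw _ p) (L * (q m + s m)) (mul_pos hκ0 hsq)
      -- As `q m ≤ s m`, the number of terms is at most `2 * L * s m`; `κ` is at least twice the
      -- resulting standard deviation divided by `√(s m)`.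
      have hhalf : ENNReal.ofReal (√((L * (q m + s m) : ℕ) * v p) / (κ * √(s m))) ≤ 1 / 2 := by
        have h1 : √((L * (q m + s m) : ℕ) * v p) ≤ √(2 * L * v p) * √(s m) := by
          rw [← Real.sqrt_mul (by positivity)]
          apply Real.sqrt_le_sqrt
          have h2 : ((q m : ℕ) : ℝ) ≤ s m := by exact_mod_cast hqs m
          push_cast
          have h3 : (0 : ℝ) ≤ L * v p := by positivity
          nlinarith
        have h2 : √((L * (q m + s m) : ℕ) * v p) / (κ * √(s m)) ≤ 1 / 2 := by
          rw [div_le_iff₀ (by positivity)]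
          nlinarith [hκ p]
        refine (ENNReal.ofReal_le_ofReal h2).trans ?_
        rw [ENNReal.ofReal_div_of_pos two_pos]
        simp
      have hcompl : (E (m, p, true))ᶜ ⊆ {ω | ∃ n ≤ L * (q m + s m),
          κ * √(s m) < |∑ i ∈ Finset.range n, X (q m + s m + i) p ω|} := by
        intro ω hω
        simp only [E, if_true, Set.mem_compl_iff, Set.mem_ofPred_eq, not_forall, not_le] at hω
        obtain ⟨N, hN, hlt⟩ := hω
        rw [Finset.mem_Icc] at hN
        rw [Finset.sum_Ico_eq_sum_range] at hlt
        exact ⟨N - (q m + s m), by omega, hlt⟩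
      have hc : P (E (m, p, true))ᶜ ≤ 1 / 2 := (measure_mono hcompl).trans (hmax.trans hhalf)
      rw [prob_compl_eq_one_sub (hEm _), tsub_le_iff_right] at hc
      have h1 : (1 / 2 : ENNReal) + 1 / 2 ≤ 1 / 2 + P (E (m, p, true)) := by
        rwa [ENNReal.add_halves]
      exact (ENNReal.add_le_add_iff_left (by simp)).1 h1
  have htsum : ∑' m, P (G m) = ⊤ := by
    refine top_unique ?_
    calc ⊤ = ∑' _m : ℕ, b := (ENNReal.tsum_const_eq_top_of_ne_zero hb).symm
      _ ≤ _ := ENNReal.tsum_le_tsum hlow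
  have hlim := measure_limsup_eq_one hGm hGind htsum
  have hae : ∀ᵐ ω ∂P, ω ∈ limsup G atTop := by
    rw [← prob_compl_eq_zero_iff (MeasurableSet.measurableSet_limsup hGm)] at hlim
    exact hlim
  filter_upwards [hae] with ω hω
  rw [mem_limsup_iff_frequently_mem] at hω
  refine hω.mono fun m hmem p => ?_
  simp only [G, Set.mem_iInter, Finset.mem_univ, true_imp_iff] at hmem
  have h1 := hmem (p, false)
  have h2 := hmem (p, true)
  simp only [E, Bool.false_eq_true, if_false, if_true, Set.mem_ofPred_eq] at h1 h2
  exact ⟨h1, h2⟩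

/-- Almost surely the noise averages tend to zero, and for any `L` and `D` there are arbitrarily
large windows `[r, L * r]` in which the averages of the sequences are separated, in the order of
their ranks, by `D / √r`. -/
theorem ae_frequently_separated [IsProbabilityMeasure P] {X : ℕ → Q → Ω → ℝ} {v : Q → ℝ≥0}
    (hv : ∀ p, 0 < v p) (hm : ∀ i p, Measurable (X i p))
    (hindep : iIndepFun (fun x : ℕ × Q => X x.1 x.2) P)
    (hlaw : ∀ i p, HasLaw (X i p) (gaussianReal 0 (v p)) P) (rank : Q → ℕ) :
    ∀ᵐ ω ∂P, (∀ p, Tendsto (fun n : ℕ => (∑ i ∈ Finset.range n, X i p ω) / n) atTop (𝓝 0)) ∧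
      ∀ L D : ℕ, 1 ≤ L → ∃ᶠ r : ℕ in atTop, ∀ p p', rank p < rank p' →
        ∀ N ∈ Finset.Icc r (L * r), ∀ N' ∈ Finset.Icc r (L * r),
          (∑ i ∈ Finset.range N, X i p ω) / N + D / √r
            ≤ (∑ i ∈ Finset.range N', X i p' ω) / N' := by
  have hslln : ∀ᵐ ω ∂P, ∀ p,
      Tendsto (fun n : ℕ => (∑ i ∈ Finset.range n, X i p ω) / n) atTop (𝓝 0) := by
    rw [ae_all_iff]
    intro p
    have hinj : Function.Injective fun i : ℕ => (i, p) := fun a b h => by simpa using h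
    have hint : Integrable (X 0 p) P := by
      have := (memLp_id_gaussianReal (μ := 0) (v := v p) 1).integrable le_rfl
      rw [← (hlaw 0 p).map_eq] at this
      exact this.comp_aemeasurable (hm 0 p).aemeasurable
    have hmean : P[X 0 p] = 0 := by
      rw [(hlaw 0 p).integral_eq, integral_id_gaussianReal]
    have := strong_law_ae_real (fun i => X i p) hint
      (fun i j hij => (hindep.precomp hinj).indepFun hij)
      (fun i => ⟨(hm i p).aemeasurable, (hm 0 p).aemeasurable,
        (hlaw i p).map_eq.trans (hlaw 0 p).map_eq.symm⟩)
    rwa [hmean] at this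
  have hsep : ∀ᵐ ω ∂P, ∀ L D : ℕ, 1 ≤ L →
      ∃ q s : ℕ → ℕ, Tendsto q atTop atTop ∧ (∀ m, 0 < s m) ∧ (∀ m, q m ^ 2 ≤ s m) ∧
        ∃ (A : Q → ℝ) (κ : ℝ), 0 < κ ∧ (∀ p, 1 ≤ A p) ∧
          (∀ p p', rank p < rank p' → L * (A p + κ + 2 + 2 * D) ≤ A p' - κ - 1) ∧
          ∃ᶠ m in atTop, ∀ p,
            (A p * √(s m) ≤ ∑ i ∈ Finset.Ico (q m) (q m + s m), X i p ω ∧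
              ∑ i ∈ Finset.Ico (q m) (q m + s m), X i p ω ≤ (A p + 1) * √(s m)) ∧
            ∀ N ∈ Finset.Icc (q m + s m) (L * (q m + s m)),
              |∑ i ∈ Finset.Ico (q m + s m) N, X i p ω| ≤ κ * √(s m) := by
    simp only [ae_all_iff]
    intro L D hL
    let κ : ℝ := 1 + ∑ p, 2 * √(2 * L * v p)
    have hκ0 : 0 < κ := by positivity
    have hκ : ∀ p, 2 * √(2 * L * v p) ≤ κ := fun p => by
      have := Finset.single_le_sum (f := fun p => 2 * √(2 * L * v p))
        (fun p _ => by positivity) (Finset.mem_univ p)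
      simp only [κ]
      linarith
    -- Targets `B ^ rank p` grow so fast that a higher rank wins even after division by a sample
    -- size `L` times larger, with room for the fluctuations and for `D`.
    let B : ℝ := κ + 1 + L * (κ + 3 + 2 * D)
    have hLD : 0 ≤ (L : ℝ) * (κ + 3 + 2 * D) := by positivity
    have hB1 : 1 ≤ B := by simp only [B]; linarith
    -- The block length `q ^ 2 + m + 1` makes all earlier noise negligible: its sum is `o(q)`, and
    -- `q ≤ √s`.
    let q : ℕ → ℕ := fun m => Nat.rec 0 (fun m x => L * (x + (x ^ 2 + m + 1))) m
    let s : ℕ → ℕ := fun m => q m ^ 2 + m + 1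
    have hqsucc : ∀ m, q (m + 1) = L * (q m + s m) := fun m => rfl
    have hs : ∀ m, 0 < s m := fun m => Nat.succ_pos _
    have hqs : ∀ m, q m ^ 2 ≤ s m := fun m => by simp only [s]; omega
    have hqs' : ∀ m, q m ≤ s m := fun m => by
      have : q m ≤ q m ^ 2 := Nat.le_self_pow two_ne_zero _
      exact this.trans (hqs m)
    have hqtop : Tendsto q atTop atTop := by
      rw [← tendsto_add_atTop_iff_nat 1]
      refine tendsto_atTop_mono (fun m => ?_) tendsto_id
      rw [hqsucc]
      have : m ≤ q m + s m := by simp only [s]; omega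
      exact this.trans (Nat.le_mul_of_pos_left _ hL)
    have hA1 : ∀ p, 1 ≤ B ^ rank p := fun p => one_le_pow₀ hB1
    have := ae_frequently_window hv hm hindep hlaw (fun p => B ^ rank p) L hκ0 hκ q s hs hqs'
      (fun m => (hqsucc m).ge) hL
    filter_upwards [this] with ω hω
    refine ⟨q, s, hqtop, hs, hqs, fun p => B ^ rank p, κ, hκ0, hA1, fun p p' hpp => ?_, hω⟩
    have h1 : B ^ rank p * B ≤ B ^ rank p' := by
      rw [← pow_succ]
      exact pow_le_pow_right₀ hB1 hpp
    have h2 := hA1 p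
    set a := B ^ rank p
    have h3 : a * B = (κ + 1) * a + L * a + L * ((κ + 2 + 2 * D) * a) := by
      simp only [B]; ring
    have h4 : κ + 1 ≤ (κ + 1) * a := le_mul_of_one_le_right (by linarith) h2
    have h5 : (L : ℝ) * (κ + 2 + 2 * D) ≤ L * ((κ + 2 + 2 * D) * a) := by
      gcongr
      exact le_mul_of_one_le_right (by positivity) h2
    linarith
  filter_upwards [hslln, hsep] with ω h1 h2
  refine ⟨h1, fun L D hL => ?_⟩
  obtain ⟨q, s, hqtop, hs, hqs, A, κ, hκ0, hA1, hA, hfreq⟩ := h2 L D hL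
  have hrtop : Tendsto (fun m => q m + s m) atTop atTop :=
    tendsto_atTop_mono (fun m => Nat.le_add_right _ _) hqtop
  have hstart : ∀ᶠ m in atTop, ∀ p, |∑ i ∈ Finset.range (q m), X i p ω| ≤ √(s m) := by
    rw [eventually_all]
    intro p
    have h3 : ∀ᶠ n : ℕ in atTop, |(∑ i ∈ Finset.range n, X i p ω) / n| < 1 := by
      have := (h1 p).abs
      rw [abs_zero] at this
      exact this.eventually_lt_const one_pos
    filter_upwards [hqtop.eventually h3, hqtop.eventually_gt_atTop 0] with m hm1 hm2
    have hq0 : (0 : ℝ) < q m := by exact_mod_cast hm2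
    rw [abs_div, Nat.abs_cast, div_lt_one hq0] at hm1
    refine hm1.le.trans (Real.le_sqrt_of_sq_le ?_)
    exact_mod_cast hqs m
  refine hrtop.frequently ((hfreq.and_eventually hstart).mono fun m hmm => ?_)
  obtain ⟨hwin, hst⟩ := hmm
  intro p p' hpp N hN N' hN'
  rw [Finset.mem_Icc] at hN hN'
  have hsplit : ∀ (p : Q) (n : ℕ), q m + s m ≤ n → ∑ i ∈ Finset.range n, X i p ω
      = ∑ i ∈ Finset.range (q m), X i p ω + ∑ i ∈ Finset.Ico (q m) (q m + s m), X i p ω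
        + ∑ i ∈ Finset.Ico (q m + s m) n, X i p ω := fun p n hn => by
    rw [Finset.range_eq_Ico, Finset.range_eq_Ico,
      Finset.sum_Ico_consecutive _ (Nat.zero_le _) (Nat.le_add_right _ _),
      Finset.sum_Ico_consecutive _ (Nat.zero_le _) hn]
  have hs0 : (0 : ℝ) < s m := by exact_mod_cast hs m
  have ha : 0 < √(s m : ℝ) := Real.sqrt_pos.2 hs0
  have hup : ∑ i ∈ Finset.range N, X i p ω ≤ (A p + κ + 2) * √(s m) := by
    rw [hsplit p N hN.1]
    have e1 := (abs_le.1 (hst p)).2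
    have e2 := (hwin p).1.2
    have e3 := (abs_le.1 ((hwin p).2 N (Finset.mem_Icc.2 hN))).2
    linarith
  have hlo : (A p' - κ - 1) * √(s m) ≤ ∑ i ∈ Finset.range N', X i p' ω := by
    rw [hsplit p' N' hN'.1]
    have e1 := (abs_le.1 (hst p')).1
    have e2 := (hwin p').1.1
    have e3 := (abs_le.1 ((hwin p').2 N' (Finset.mem_Icc.2 hN'))).1
    linarith
  -- The generous factor `4` has a convenient root, `√r ≤ 2 * √s`.
  have hrs : ((q m + s m : ℕ) : ℝ) ≤ 4 * s m := by
    have : q m ≤ q m ^ 2 := Nat.le_self_pow two_ne_zero _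
    have := hqs m
    exact_mod_cast (by omega : q m + s m ≤ 4 * s m)
  have hr0 : (0 : ℝ) < (q m + s m : ℕ) := by
    have := hs m
    exact_mod_cast (by omega : 0 < q m + s m)
  set r : ℝ := ((q m + s m : ℕ) : ℝ) with hr
  have hN1 : r ≤ N := by rw [hr]; exact_mod_cast hN.1
  have hN2 : (N' : ℝ) ≤ L * r := by rw [hr]; exact_mod_cast hN'.2
  have hN3 : r ≤ N' := by rw [hr]; exact_mod_cast hN'.1
  have hL0 : (0 : ℝ) < L := by exact_mod_cast hL
  have hsqr : √r ≤ 2 * √(s m : ℝ) := by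
    refine Real.sqrt_le_iff.2 ⟨by positivity, ?_⟩
    rw [mul_pow, Real.sq_sqrt hs0.le]
    linarith
  have hD : (D : ℝ) / √r ≤ 2 * D * √(s m : ℝ) / r := by
    rw [div_le_div_iff₀ (Real.sqrt_pos.2 hr0) hr0]
    calc (D : ℝ) * r = D * (√r * √r) := by rw [Real.mul_self_sqrt hr0.le]
      _ ≤ D * (2 * √(s m : ℝ) * √r) := by gcongr
      _ = _ := by ring
  have hAp := hA1 p
  have hAA := hA p p' hpp
  have hnum : 0 ≤ A p' - κ - 1 := le_trans (by positivity) hAA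
  calc (∑ i ∈ Finset.range N, X i p ω) / N + D / √r
      ≤ (A p + κ + 2) * √(s m) / r + 2 * D * √(s m : ℝ) / r := by
        refine add_le_add ?_ hD
        calc _ ≤ (A p + κ + 2) * √(s m) / N := by gcongr
          _ ≤ _ := by gcongr
    _ = L * (A p + κ + 2 + 2 * D) * √(s m : ℝ) / (L * r) := by field_simp
    _ ≤ (A p' - κ - 1) * √(s m : ℝ) / (L * r) := by gcongr
    _ ≤ (A p' - κ - 1) * √(s m : ℝ) / N' := by gcongr; linarith
    _ ≤ _ := by gcongr

end Windows

/-! ### Bookkeeping along a run, and growth of counts -/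

section Run

variable {K C : Type*} [DecidableEq K] [DecidableEq C]

theorem count_run_succ (δ : Policy K C) (F : K → C → ℝ) (e : ℕ → K → C → ℝ) (n : ℕ)
    (p : K × C) :
    (run δ F e (n + 1)).count p
      = (run δ F e n).count p + if δ n (run δ F e n) = p then 1 else 0 := by
  simp only [History.count, run, Finset.card_filter]
  rw [Fin.sum_univ_castSucc]
  simp

theorem count_run_zero (δ : Policy K C) (F : K → C → ℝ) (e : ℕ → K → C → ℝ) (p : K × C) :
    (run δ F e 0).count p = 0 := by
  simp [History.count]

theorem count_run_mono (δ : Policy K C) (F : K → C → ℝ) (e : ℕ → K → C → ℝ) (p : K × C) :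
    Monotone fun n => (run δ F e n).count p :=
  monotone_nat_of_le_succ fun n => by
    rw [count_run_succ]
    exact Nat.le_add_right _ _

theorem sum_count_run [Fintype K] [Fintype C] (δ : Policy K C) (F : K → C → ℝ)
    (e : ℕ → K → C → ℝ) (n : ℕ) :
    ∑ p, (run δ F e n).count p = n := by
  induction n with
  | zero => simp [count_run_zero]
  | succ n ih =>
    simp_rw [count_run_succ]
    rw [Finset.sum_add_distrib, ih]
    simp

theorem obsSum_run (δ : Policy K C) (F : K → C → ℝ) (e : ℕ → K → C → ℝ) (n : ℕ) (p : K × C) :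
    (run δ F e n).obsSum p
      = (run δ F e n).count p * F p.1 p.2
        + ∑ j ∈ Finset.range ((run δ F e n).count p), e j p.1 p.2 := by
  induction n with
  | zero => simp [History.obsSum, count_run_zero]
  | succ n ih =>
    have h1 : (run δ F e (n + 1)).obsSum p = (run δ F e n).obsSum p
        + if δ n (run δ F e n) = p then F p.1 p.2 + e ((run δ F e n).count p) p.1 p.2 else 0 := by
      simp only [History.obsSum, Finset.sum_filter]
      rw [Fin.sum_univ_castSucc]
      simp only [run, Fin.snoc_castSucc, Fin.snoc_last]
      congr 1
      split_ifs with h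
      · rw [h]
      · rfl
    rw [h1, ih, count_run_succ]
    split_ifs with h
    · rw [Finset.sum_range_succ]
      push_cast
      ring
    · simp

end Run

/-- Counts stay bounded if, whenever a large count increases, it is not much larger than some other
count, and belongs to the largest of all those elements, in some asymmetric relation, whose counts
are at least `r`. -/
theorem counts_le_of_increments {K : Type*} [Fintype K] [DecidableEq K] {N : ℕ → K → ℕ}
    {lt : K → K → Prop} (hlt : ∀ i j, lt i j → ¬ lt j i) {A r n₀ : ℕ} (hA : 1 ≤ A)
    (h0 : ∀ k, N n₀ k < r)
    (hstep : ∀ n, n₀ ≤ n → (∀ k, N (n + 1) k = N n k) ∨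
      ∃ s, (∀ k, N (n + 1) k = N n k + if s = k then 1 else 0) ∧
        (∃ i, i ≠ s ∧ N n s ≤ A * N n i) ∧
        (r ≤ N n s → (∃ i, A * r ≤ N n i) →
          (∀ i, N n i ≤ (2 * A) ^ (Fintype.card K + 1) * r) →
          ∀ i, i ≠ s → r ≤ N n i → lt i s)) :
    ∀ n, n₀ ≤ n → ∀ k, N n k ≤ (2 * A) ^ (Fintype.card K + 1) * r := by
  have hD1 : 1 ≤ 2 * A := by omega
  let H : ℕ → ℕ := fun n => (Finset.univ.filter fun i => r ≤ N n i).card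
  have hHle : ∀ n, H n ≤ Fintype.card K := fun n => Finset.card_le_univ _
  have hpow : ∀ {a b : ℕ}, a ≤ b → (2 * A) ^ a * r ≤ (2 * A) ^ b * r := fun h =>
    Nat.mul_le_mul_right _ (Nat.pow_le_pow_right hD1 h)
  have hr_le : ∀ a, r ≤ (2 * A) ^ a * r := fun a => Nat.le_mul_of_pos_left _ (by positivity)
  -- Induction with an exponent that depends on the number `H n` of counts that have reached `r`:
  -- only an element not below any other such element may exceed `(2 * A) ^ H n * r`. A count that
  -- reaches `r` raises `H`, which absorbs all old bounds. A larger count that grows belongs to the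
  -- top element, or else all counts are below `A * r`; at the top, its rival obeys the smaller
  -- bound, so the factor `A` suffices, and the `2` absorbs the increment.
  suffices hinv : ∀ n, n₀ ≤ n → (∀ i, N n i ≤ (2 * A) ^ (H n + 1) * r) ∧
      ∀ i j, r ≤ N n j → lt i j → N n i ≤ (2 * A) ^ H n * r from fun n hn k =>
    ((hinv n hn).1 k).trans (hpow (Nat.succ_le_succ (hHle n)))
  intro n hn
  induction n, hn using Nat.le_induction with
  | base => exact ⟨fun i => (h0 i).le.trans (hr_le _), fun i j _ _ => (h0 i).le.trans (hr_le _)⟩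
  | succ n hn ih =>
    obtain ⟨ih1, ih2⟩ := ih
    rcases hstep n hn with h | ⟨s, hs, ⟨i₀, hi₀, hle⟩, htop⟩
    · have hH : H (n + 1) = H n := by simp only [H, h]
      simp only [h, hH]
      exact ⟨ih1, ih2⟩
    have hother : ∀ k, k ≠ s → N (n + 1) k = N n k := fun k hk => by
      rw [hs, if_neg (Ne.symm hk), add_zero]
    have hself : N (n + 1) s = N n s + 1 := by rw [hs, if_pos rfl]
    have hmono : ∀ k, N n k ≤ N (n + 1) k := fun k => by rw [hs]; omega
    rcases lt_or_ge (N n s) r with hlow | hhigh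
    · rcases Nat.lt_or_ge (N n s + 1) r with hlow' | hnew
      · have hH : H (n + 1) = H n := by
          simp only [H]
          congr 1
          ext k
          simp only [Finset.mem_filter, Finset.mem_univ, true_and]
          rcases eq_or_ne k s with rfl | hk
          · omega
          · rw [hother k hk]
        rw [hH]
        refine ⟨fun i => ?_, fun i j hj hij => ?_⟩
        · rcases eq_or_ne i s with rfl | hi
          · rw [hself]; exact hlow'.le.trans (hr_le _)
          · rw [hother i hi]; exact ih1 i
        · rcases eq_or_ne i s with rfl | hi
          · rw [hself]; exact hlow'.le.trans (hr_le _)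
          · rw [hother i hi]
            rcases eq_or_ne j s with rfl | hj'
            · omega
            · rw [hother j hj'] at hj
              exact ih2 i j hj hij
      · have hH : H n + 1 ≤ H (n + 1) := by
          refine Finset.card_lt_card ?_
          rw [Finset.ssubset_iff]
          refine ⟨s, by simpa using hlow, fun k hk => ?_⟩
          simp only [Finset.mem_insert, Finset.mem_filter, Finset.mem_univ, true_and] at hk ⊢
          rcases hk with rfl | hk
          · omega
          · exact hk.trans (hmono k)
        have hall : ∀ i, N (n + 1) i ≤ (2 * A) ^ H (n + 1) * r := fun i => by
          rcases eq_or_ne i s with rfl | hi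
          · rw [hself]; exact (Nat.succ_le_of_lt hlow).trans (hr_le _)
          · rw [hother i hi]; exact (ih1 i).trans (hpow hH)
        exact ⟨fun i => (hall i).trans (hpow (Nat.le_succ _)), fun i j _ _ => hall i⟩
    · have hH : H (n + 1) = H n := by
        simp only [H]
        congr 1
        ext k
        simp only [Finset.mem_filter, Finset.mem_univ, true_and]
        rcases eq_or_ne k s with rfl | hk
        · omega
        · rw [hother k hk]
      have hHpos : 1 ≤ H n := Finset.card_pos.2 ⟨s, by simpa using hhigh⟩
      have hr : 1 ≤ r := Nat.one_le_iff_ne_zero.2 fun h => by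
        have := h0 s; omega
      rw [hH]
      by_cases hbig : ∃ i, A * r ≤ N n i
      · have htop' := htop hhigh hbig fun i =>
          (ih1 i).trans (hpow (Nat.succ_le_succ (hHle n)))
        have hi₀le : N n i₀ ≤ (2 * A) ^ H n * r := by
          rcases lt_or_ge (N n i₀) r with h | h
          · exact h.le.trans (hr_le _)
          · exact ih2 i₀ s hhigh (htop' i₀ hi₀ h)
        refine ⟨fun i => ?_, fun i j hj hij => ?_⟩
        · rcases eq_or_ne i s with rfl | hi
          · rw [hself]
            have h1 : A * N n i₀ ≤ A * ((2 * A) ^ H n * r) := Nat.mul_le_mul_left _ hi₀le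
            have h2 : 1 ≤ A * ((2 * A) ^ H n * r) := Nat.mul_pos hA (hr.trans (hr_le _))
            have h3 : (2 * A) ^ (H n + 1) * r = 2 * (A * ((2 * A) ^ H n * r)) := by ring
            omega
          · rw [hother i hi]; exact ih1 i
        · rcases eq_or_ne i s with rfl | hi
          · rcases eq_or_ne j i with rfl | hj'
            · exact (hlt _ _ hij hij).elim
            · rw [hother j hj'] at hj
              exact (hlt _ _ hij (htop' j hj' hj)).elim
          · rw [hother i hi]
            rcases eq_or_ne j s with rfl | hj'
            · exact ih2 i j hhigh hij
            · rw [hother j hj'] at hj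
              exact ih2 i j hj hij
      · push Not at hbig
        have hall : ∀ i, N (n + 1) i ≤ (2 * A) ^ H n * r := fun i => by
          have h1 : N (n + 1) i ≤ A * r := by
            have := hbig i
            rw [hs]
            split_ifs <;> omega
          calc N (n + 1) i ≤ A * r := h1
            _ ≤ (2 * A) ^ 1 * r := Nat.mul_le_mul_right _ (by rw [pow_one]; omega)
            _ ≤ _ := hpow hHpos
        exact ⟨fun i => (hall i).trans (hpow (Nat.le_succ _)), fun i j _ _ => hall i⟩

/-! ### Consequences of a single step of the policy -/

section Step

variable {K C : Type*} [DecidableEq K] [DecidableEq C]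

/-- A GP-C-OCBA step evaluates no pair whose number of observations is large in comparison with
those of all other alternatives in the same context. -/
theorem GPModel.IsGPCOCBAStep.exists_count_le [Fintype K] {M : GPModel K C} {n : ℕ}
    {h : History K C n} {p : K × C} (hp : M.IsGPCOCBAStep h p) (hn : 0 < n) {a V : ℝ} (ha : 0 < a)
    (hpos : ∀ k c, 0 < M.postVar h k c)
    (hlow : ∀ k c, a ≤ M.postVar h k c * (1 + h.count (k, c)))
    (hup : ∀ k c, M.postVar h k c * h.count (k, c) ≤ V) {A : ℕ} (hA1 : 1 ≤ A)
    (hA : V * (Fintype.card K * (2 / a)) ≤ A) :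
    ∃ (b : C → K) (k : K), (∀ c k, M.postMean h k c ≤ M.postMean h (b c) c) ∧ k ≠ b p.2 ∧
      (∀ k' c', k' ≠ b c' → M.zeta h b k p.2 ≤ M.zeta h b k' c') ∧
      ((p.1 = b p.2 ∧ ∃ i, i ≠ b p.2 ∧ h.count (b p.2, p.2) ≤ A * h.count (i, p.2)) ∨
        (p.1 = k ∧ ∀ i, i ≠ b p.2 → h.count (i, p.2) ≤ A * h.count (b p.2, p.2))) := by
  obtain ⟨b, hb, k, c, hkb, hmin, hcase⟩ := hp
  have hn' : (0 : ℝ) < n := by exact_mod_cast hn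
  have hV0 : 0 ≤ V := le_trans (mul_nonneg (hpos k c).le (Nat.cast_nonneg _)) (hup k c)
  -- As the posterior variance is of order `1 / (1 + N)`, the ratios in `ψ⁽¹⁾` and `ψ⁽²⁾` are
  -- comparable to `N ^ 2 / n`; zero counts are included.
  have hfl : ∀ k, (h.count (k, c) : ℝ) ^ 2 / n ≤ V * (h.frac (k, c) / M.postVar h k c) := by
    intro k
    have h1 := hup k c
    have h2 := hpos k c
    rw [History.frac, div_div, mul_div_assoc', div_le_div_iff₀ hn' (by positivity)]
    have h3 : (0 : ℝ) ≤ h.count (k, c) * n := by positivity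
    nlinarith [mul_le_mul_of_nonneg_right h1 h3]
  have hfu : ∀ k, h.frac (k, c) / M.postVar h k c ≤ 2 / a * ((h.count (k, c) : ℝ) ^ 2 / n) := by
    intro k
    have h1 := hlow k c
    have h2 := hpos k c
    have h4 : (h.count (k, c) : ℝ) ≤ (h.count (k, c) : ℝ) ^ 2 := by
      exact_mod_cast Nat.le_self_pow two_ne_zero _
    have h5 : (0 : ℝ) ≤ h.count (k, c) := Nat.cast_nonneg _
    rw [History.frac, div_div, div_mul_div_comm, div_le_div_iff₀ (by positivity) (by positivity)]
    have h6 : h.count (k, c) * a ≤ 2 * (h.count (k, c) : ℝ) ^ 2 * M.postVar h k c := by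
      nlinarith [mul_le_mul_of_nonneg_left h1 h5, mul_le_mul_of_nonneg_right h4 h2.le]
    nlinarith [mul_le_mul_of_nonneg_right h6 hn'.le]
  have hsq : ∀ x y : ℕ, (x : ℝ) ^ 2 / n ≤ V * (Fintype.card K * (2 / a)) * ((y : ℝ) ^ 2 / n) →
      x ≤ A * y := by
    intro x y hxy
    have hA1' : (1 : ℝ) ≤ A := by exact_mod_cast hA1
    have h1 : (x : ℝ) ^ 2 ≤ A * (y : ℝ) ^ 2 := by
      have h2 : (x : ℝ) ^ 2 / n ≤ A * ((y : ℝ) ^ 2 / n) := hxy.trans (by gcongr)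
      rw [mul_div_assoc', div_le_div_iff_of_pos_right hn'] at h2
      exact h2
    have h3 : (x : ℝ) ^ 2 ≤ (A * y : ℝ) ^ 2 := by
      rw [mul_pow]
      refine h1.trans ?_
      gcongr
      nlinarith
    have h4 : (x : ℝ) ≤ A * y := le_of_sq_le_sq h3 (by positivity)
    exact_mod_cast h4
  have hcard : 1 ≤ Fintype.card K := Fintype.card_pos_iff.2 ⟨k⟩
  rcases hcase with ⟨hpsi, rfl⟩ | ⟨hpsi, rfl⟩
  · refine ⟨b, k, hb, hkb, hmin, Or.inl ⟨rfl, ?_⟩⟩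
    obtain ⟨i, hi, hmax⟩ := Finset.exists_max_image (Finset.univ.filter fun k => k ≠ b c)
      (fun k => h.count (k, c)) ⟨k, by simpa using hkb⟩
    refine ⟨i, by simpa using hi, hsq _ _ ?_⟩
    have hsum : M.psi₂ h b c ≤ Fintype.card K * (2 / a * ((h.count (i, c) : ℝ) ^ 2 / n)) := by
      calc M.psi₂ h b c ≤ ∑ k ∈ Finset.univ.filter (fun k => k ≠ b c),
            2 / a * ((h.count (i, c) : ℝ) ^ 2 / n) := by
            refine Finset.sum_le_sum fun k hk => (hfu k).trans ?_
            gcongr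
            exact hmax k hk
        _ ≤ ∑ k : K, 2 / a * ((h.count (i, c) : ℝ) ^ 2 / n) :=
            Finset.sum_le_sum_of_subset_of_nonneg (Finset.filter_subset _ _)
              fun _ _ _ => by positivity
        _ = _ := by simp
    calc _ ≤ V * M.psi₁ h b c := hfl (b c)
      _ ≤ V * (Fintype.card K * (2 / a * ((h.count (i, c) : ℝ) ^ 2 / n))) := by
        gcongr
        exact hpsi.le.trans hsum
      _ = _ := by ring
  · refine ⟨b, k, hb, hkb, hmin, Or.inr ⟨rfl, fun i hi => hsq _ _ ?_⟩⟩
    have h1 : h.frac (i, c) / M.postVar h i c ≤ M.psi₂ h b c := by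
      refine Finset.single_le_sum (f := fun k => h.frac (k, c) / M.postVar h k c)
        (fun k _ => ?_) (by simpa using hi)
      have := hpos k c
      simp only [History.frac]
      positivity
    calc _ ≤ V * (h.frac (i, c) / M.postVar h i c) := hfl i
      _ ≤ V * (2 / a * ((h.count (b c, c) : ℝ) ^ 2 / n)) := by
        gcongr
        exact h1.trans ((not_lt.1 hpsi).trans (hfu (b c)))
      _ ≤ V * (Fintype.card K * (2 / a * ((h.count (b c, c) : ℝ) ^ 2 / n))) := by
        refine mul_le_mul_of_nonneg_left ?_ hV0
        exact le_mul_of_one_le_left (by positivity) (by exact_mod_cast hcard)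
      _ = _ := by ring

/-- If the number of observations of one pair, and the posterior means, stay bounded, then so does
the minimum of `ζ`. -/
theorem GPModel.exists_zeta_le [Nontrivial K] {M : GPModel K C} {n : ℕ} {h : History K C n}
    {a D x : ℝ} (ha : 0 < a) (hpos : ∀ k c, 0 < M.postVar h k c)
    (hlow : ∀ k c, a ≤ M.postVar h k c * (1 + h.count (k, c)))
    (hD : ∀ k c, |M.postMean h k c| ≤ D) (k₀ : K) (c₀ : C) (hx : h.count (k₀, c₀) ≤ x)
    (b : C → K) : ∃ k, k ≠ b c₀ ∧ M.zeta h b k c₀ ≤ (2 * D) ^ 2 * (1 + x) / a := by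
  have hx0 : 0 ≤ x := (Nat.cast_nonneg _).trans hx
  have key : ∀ k, a / (1 + x) ≤ M.postVar h (b c₀) c₀ + M.postVar h k c₀ →
      M.zeta h b k c₀ ≤ (2 * D) ^ 2 * (1 + x) / a := by
    intro k hk
    have h1 : |M.postMean h (b c₀) c₀ - M.postMean h k c₀| ≤ 2 * D :=
      (abs_sub _ _).trans (by linarith [hD (b c₀) c₀, hD k c₀])
    calc M.zeta h b k c₀ ≤ (2 * D) ^ 2 / (a / (1 + x)) := by
          rw [GPModel.zeta, ← sq_abs]
          gcongr
      _ = _ := by field_simp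
  have hk₀ : a / (1 + x) ≤ M.postVar h k₀ c₀ := by
    rw [div_le_iff₀ (by positivity)]
    refine (hlow k₀ c₀).trans ?_
    have := hpos k₀ c₀
    gcongr
  -- If `k₀` is the predicted best, every challenger in `c₀` has its variance in the denominator of
  -- `ζ`; otherwise `k₀` is the challenger.
  by_cases hb : k₀ = b c₀
  · obtain ⟨k, hk⟩ := exists_ne k₀
    refine ⟨k, hb ▸ hk, key k ?_⟩
    rw [← hb]
    linarith [hpos k c₀]
  · exact ⟨k₀, hb, key k₀ (by linarith [hpos (b c₀) c₀])⟩

end Step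

/-- A strict gap in rewards dominates all vanishing errors; no special windows are needed for such
alternatives. -/
theorem eventually_forall_add_le_sub {f g : ℝ} (hfg : f < g) {u w : ℕ → ℝ}
    (hu : Tendsto u atTop (𝓝 0)) (hw : Tendsto w atTop (𝓝 0)) (D E : ℝ) :
    ∀ᶠ r : ℕ in atTop, ∀ N ≥ r, ∀ N' ≥ r,
      f + u N + D / N + E / √r ≤ g + w N' - D / N' := by
  have hDN : Tendsto (fun N : ℕ => D / (N : ℝ)) atTop (𝓝 0) :=
    tendsto_const_div_atTop_nhds_zero_nat D
  have h1 : Tendsto (fun N : ℕ => u N + D / N) atTop (𝓝 0) := by simpa using hu.add hDN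
  have h2 : Tendsto (fun N : ℕ => w N - D / N) atTop (𝓝 0) := by simpa using hw.sub hDN
  have h3 : Tendsto (fun r : ℕ => E / √(r : ℝ)) atTop (𝓝 0) :=
    (Real.tendsto_sqrt_atTop.comp tendsto_natCast_atTop_atTop).const_div_atTop E
  have hδ : 0 < (g - f) / 4 := by linarith
  filter_upwards [eventually_forall_ge_atTop.2 (h1.eventually_lt_const hδ),
    eventually_forall_ge_atTop.2 (h2.eventually_const_lt (neg_lt_zero.2 hδ)),
    h3.eventually_lt_const hδ] with r e1 e2 e3 N hN N' hN'
  have := e1 N hN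
  have := e2 N' hN'
  linarith

/-! ### The pathwise contradiction -/

section Pathwise

variable {K C : Type*} [Fintype K] [DecidableEq K] [Fintype C] [DecidableEq C]

/-- The pathwise form of the main theorem: if the averages of the noise of each pair tend to zero,
and are separated from each other in arbitrarily large windows, then all numbers of observations
tend to infinity. -/
theorem tendsto_count_run [Nontrivial K] {M : GPModel K C}
    (hnoise : ∀ k c, 0 < M.noiseVar k c) (hprior : ∀ k, (M.priorCov k).PosDef)
    (F : K → C → ℝ) {N₀ : ℕ} {init : ℕ → K × C} {δ : Policy K C} (hδ : IsGPCOCBA M N₀ init δ)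
    {e : ℕ → K → C → ℝ} {rank : K → ℕ} (hrank : Function.Injective rank)
    (havg : ∀ k c, Tendsto (fun n : ℕ => (∑ i ∈ Finset.range n, e i k c) / n) atTop (𝓝 0))
    (hsep : ∀ L D : ℕ, 1 ≤ L → ∃ᶠ r : ℕ in atTop, ∀ c i j, rank i < rank j →
      ∀ N ∈ Finset.Icc r (L * r), ∀ N' ∈ Finset.Icc r (L * r),
        (∑ m ∈ Finset.range N, e m i c) / N + D / √r ≤ (∑ m ∈ Finset.range N', e m j c) / N')
    (k₀ : K) (c₀ : C) :
    Tendsto (fun n => (run δ F e n).count (k₀, c₀)) atTop atTop := by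
  by_contra hnot
  obtain ⟨x, hx⟩ : ∃ x, ∀ n, (run δ F e n).count (k₀, c₀) ≤ x := by
    by_contra! hcon
    exact hnot (tendsto_atTop_atTop_of_monotone (count_run_mono δ F e _)
      fun x => (hcon x).imp fun n hn => hn.le)
  obtain ⟨R, hR⟩ : ∃ R : ℝ, ∀ n p, |(run δ F e n).obsSum p| ≤ R * (run δ F e n).count p := by
    have hb : ∀ p : K × C, ∃ R : ℝ, ∀ N : ℕ,
        |N * F p.1 p.2 + ∑ i ∈ Finset.range N, e i p.1 p.2| ≤ R * N := by
      intro p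
      obtain ⟨R, hR⟩ := (havg p.1 p.2).abs.bddAbove_range
      refine ⟨|F p.1 p.2| + R, fun N => ?_⟩
      rcases Nat.eq_zero_or_pos N with rfl | hN
      · simp
      have hN' : (0 : ℝ) < N := by exact_mod_cast hN
      have h1 := hR ⟨N, rfl⟩
      simp only [abs_div, Nat.abs_cast] at h1
      rw [div_le_iff₀ hN'] at h1
      refine (abs_add_le _ _).trans ?_
      rw [abs_mul, Nat.abs_cast]
      linarith
    choose R hR using hb
    obtain ⟨S, hS⟩ := Finite.bddAbove_range R
    refine ⟨S, fun n p => ?_⟩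
    rw [obsSum_run]
    refine (hR p _).trans ?_
    gcongr
    exact hS ⟨p, rfl⟩
  obtain ⟨D, hD0, hD⟩ := GPModel.exists_postMean_bound hnoise hprior R
  have hDmean := fun n k c => (hD n _ (hR n) k c).1
  obtain ⟨a, ha, hlow, V, hup⟩ : ∃ a : ℝ, 0 < a ∧
      (∀ (n : ℕ) (h : History K C n) k c, a ≤ M.postVar h k c * (1 + h.count (k, c))) ∧
      ∃ V : ℝ, ∀ (n : ℕ) (h : History K C n) k c, M.postVar h k c * h.count (k, c) ≤ V := by
    choose a ha hav using fun k => M.exists_postVar_bound hnoise hprior k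
    obtain ⟨k, hk⟩ := Finite.exists_min a
    obtain ⟨V, hV⟩ := Finite.bddAbove_range fun p : K × C => (M.noiseVar p.1 p.2 : ℝ)
    exact ⟨a k, ha k, fun n h k' c => (hk k').trans (hav k' n h c).1, V,
      fun n h k c => (hav k n h c).2.trans (hV ⟨(k, c), rfl⟩)⟩
  have hpos : ∀ (n : ℕ) (h : History K C n) k c, 0 < M.postVar h k c := fun n h k c =>
    pos_of_mul_pos_left (ha.trans_le (hlow n h k c)) (by positivity)
  have hV0 : 0 ≤ V := le_trans
    (mul_nonneg (hpos 0 (run δ F e 0) k₀ c₀).le (Nat.cast_nonneg _)) (hup 0 (run δ F e 0) k₀ c₀)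
  obtain ⟨B, hB0, hB⟩ : ∃ B : ℝ, 0 ≤ B ∧ ∀ n (b : C → K),
      ∃ k, k ≠ b c₀ ∧ M.zeta (run δ F e n) b k c₀ ≤ B :=
    ⟨(2 * D) ^ 2 * (1 + x) / a, by positivity, fun n b =>
      GPModel.exists_zeta_le ha (hpos n _) (hlow n _) (hDmean n) k₀ c₀ (by exact_mod_cast hx n) b⟩
  obtain ⟨A, hA⟩ := exists_nat_ge (V * (Fintype.card K * (2 / a)) + 1)
  have hA1 : 1 ≤ A := by
    have : (1 : ℝ) ≤ A := le_trans (le_add_of_nonneg_left (by positivity)) hA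
    exact_mod_cast this
  -- A gap `E / √r` in means against variances at most `V / r` gives `ζ ≥ E ^ 2 / (2 * V)` when `V >
  -- 0`, and `E ≤ E ^ 2`, so this choice makes `ζ > B`.
  obtain ⟨E, hE⟩ := exists_nat_gt (2 * B * V)
  have hE0 : (0 : ℝ) < E := lt_of_le_of_lt (by positivity) hE
  have hE1 : (1 : ℝ) ≤ E := by exact_mod_cast (by exact_mod_cast hE0 : 0 < E)
  let L : ℕ := (2 * A) ^ (Fintype.card K + 1)
  have hL1 : 1 ≤ L := Nat.one_le_pow _ _ (by omega)
  have hbound : ∀ c, ∃ S, ∀ n k, (run δ F e n).count (k, c) ≤ S := by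
    intro c
    -- The order of the rewards, with equal rewards ordered as the noise averages are in the chosen
    -- window.
    let lt : K → K → Prop := fun i j => F i c < F j c ∨ (F i c = F j c ∧ rank i < rank j)
    have hlt : ∀ i j, lt i j → ¬ lt j i := by
      rintro i j (h | ⟨h, h'⟩) (h1 | ⟨h1, h1'⟩)
      · exact lt_asymm h h1
      · exact h.ne' h1
      · exact h1.ne' h
      · exact lt_asymm h' h1'
    have htri : ∀ i j, i ≠ j → lt i j ∨ lt j i := by
      intro i j hij
      rcases lt_trichotomy (F i c) (F j c) with h | h | h
      · exact Or.inl (Or.inl h)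
      · rcases lt_or_gt_of_ne (hrank.ne hij) with h' | h'
        · exact Or.inl (Or.inr ⟨h, h'⟩)
        · exact Or.inr (Or.inr ⟨h.symm, h'⟩)
      · exact Or.inr (Or.inl h)
    have hgap : ∃ᶠ r : ℕ in atTop, ∀ i j, lt i j →
        ∀ N ∈ Finset.Icc r (L * r), ∀ N' ∈ Finset.Icc r (L * r),
          F i c + (∑ m ∈ Finset.range N, e m i c) / N + D / N + E / √r
            ≤ F j c + (∑ m ∈ Finset.range N', e m j c) / N' - D / N' := by
      have hne : ∀ᶠ r : ℕ in atTop, ∀ i j, F i c < F j c → ∀ N ≥ r, ∀ N' ≥ r,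
          F i c + (∑ m ∈ Finset.range N, e m i c) / N + D / N + E / √r
            ≤ F j c + (∑ m ∈ Finset.range N', e m j c) / N' - D / N' := by
        simp only [eventually_all]
        exact fun i j hij => eventually_forall_add_le_sub hij (havg i c) (havg j c) D E
      have hlarge : ∀ᶠ r : ℕ in atTop, 4 * D ^ 2 + 1 ≤ (r : ℝ) :=
        tendsto_natCast_atTop_atTop.eventually_ge_atTop _
      -- The extra `1 / √r` pays for the two errors `D / N` and `D / N'` of the posterior means,
      -- each at most `1 / (2 * √r)` once `r ≥ 4 * D ^ 2`.
      refine ((hsep L (E + 1) hL1).and_eventually (hne.and hlarge)).mono ?_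
      rintro r ⟨h1, h2, h3⟩ i j hij N hN N' hN'
      rw [Finset.mem_Icc] at hN hN'
      rcases hij with hij | ⟨hF, hij⟩
      · exact h2 i j hij N hN.1 N' hN'.1
      · have h4 := h1 c i j hij N (Finset.mem_Icc.2 hN) N' (Finset.mem_Icc.2 hN')
        have hr0 : (0 : ℝ) < r := lt_of_lt_of_le (by positivity) h3
        have hsr : 2 * D ≤ √(r : ℝ) := Real.le_sqrt_of_sq_le (by nlinarith)
        have hDr : D / r ≤ 1 / 2 / √(r : ℝ) := by
          rw [div_le_div_iff₀ hr0 (Real.sqrt_pos.2 hr0)]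
          calc D * √(r : ℝ) ≤ √(r : ℝ) / 2 * √(r : ℝ) := by gcongr; linarith
            _ = 1 / 2 * r := by
              rw [div_mul_eq_mul_div, Real.mul_self_sqrt hr0.le]; ring
        have hDN : D / N ≤ D / r := by
          gcongr; exact hN.1
        have hDN' : D / N' ≤ D / r := by
          gcongr; exact hN'.1
        have h5 : (((E + 1 : ℕ) : ℝ)) / √(r : ℝ)
            = E / √(r : ℝ) + 1 / 2 / √(r : ℝ) + 1 / 2 / √(r : ℝ) := by
          push_cast; ring
        rw [h5] at h4
        rw [hF]
        linarith
    have hlarge : ∀ᶠ r : ℕ in atTop, ∀ k, (run δ F e N₀).count (k, c) < r :=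
      eventually_all.2 fun k => eventually_gt_atTop _
    obtain ⟨r, hr, hr0⟩ := (hgap.and_eventually hlarge).exists
    have hrpos : 0 < r := (Nat.zero_le _).trans_lt (hr0 k₀)
    have hrpos' : (0 : ℝ) < r := by exact_mod_cast hrpos
    have hmean : ∀ n i j, lt i j →
        (run δ F e n).count (i, c) ∈ Finset.Icc r (L * r) →
        (run δ F e n).count (j, c) ∈ Finset.Icc r (L * r) →
        M.postMean (run δ F e n) i c + E / √r ≤ M.postMean (run δ F e n) j c := by
      have hclose : ∀ n i, r ≤ (run δ F e n).count (i, c) →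
          |M.postMean (run δ F e n) i c - (F i c + (∑ m ∈ Finset.range
            ((run δ F e n).count (i, c)), e m i c) / (run δ F e n).count (i, c))|
            ≤ D / (run δ F e n).count (i, c) := by
        intro n i hi
        have hN : (0 : ℝ) < (run δ F e n).count (i, c) := by
          exact_mod_cast hrpos.trans_le hi
        have h1 := (hD n _ (hR n) i c).2
        rw [obsSum_run] at h1
        rw [le_div_iff₀ hN]
        refine le_trans (le_of_eq ?_) h1
        refine (congrArg _ (abs_of_pos hN).symm).trans ((abs_mul _ _).symm.trans ?_)
        congr 1
        field_simp
      intro n i j hij hi hj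
      have h1 := hr i j hij _ hi _ hj
      have h2 := (abs_le.1 (hclose n i (Finset.mem_Icc.1 hi).1)).2
      have h3 := (abs_le.1 (hclose n j (Finset.mem_Icc.1 hj).1)).1
      linarith
    have hEr : 0 < E / √(r : ℝ) := div_pos hE0 (Real.sqrt_pos.2 hrpos')
    have hzeta : ∀ n (b : C → K) k, k ≠ b c →
        (run δ F e n).count (k, c) ∈ Finset.Icc r (L * r) →
        (run δ F e n).count (b c, c) ∈ Finset.Icc r (L * r) →
        B < M.zeta (run δ F e n) b k c := by
      intro n b k hk hkr hbr
      have hdiff : E / √(r : ℝ) ≤ |M.postMean (run δ F e n) (b c) c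
          - M.postMean (run δ F e n) k c| := by
        rcases htri _ _ hk with h | h
        · have := hmean n _ _ h hkr hbr
          exact le_trans (by linarith) (le_abs_self _)
        · have := hmean n _ _ h hbr hkr
          exact le_trans (by linarith) (neg_le_abs _)
      have hvar : ∀ i, (run δ F e n).count (i, c) ∈ Finset.Icc r (L * r) →
          M.postVar (run δ F e n) i c ≤ V / r := by
        intro i hi
        rw [le_div_iff₀ hrpos']
        refine le_trans ?_ (hup n (run δ F e n) i c)
        have := hpos n (run δ F e n) i c
        gcongr
        exact (Finset.mem_Icc.1 hi).1
      rw [GPModel.zeta, lt_div_iff₀ (add_pos (hpos n _ _ _) (hpos n _ _ _))]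
      calc B * (M.postVar (run δ F e n) (b c) c + M.postVar (run δ F e n) k c)
          ≤ B * (V / r + V / r) := by
            gcongr
            · exact hvar _ hbr
            · exact hvar _ hkr
        _ = 2 * B * V / r := by ring
        _ < E ^ 2 / r := by
            gcongr
            nlinarith
        _ = (E / √(r : ℝ)) ^ 2 := by rw [div_pow, Real.sq_sqrt hrpos'.le]
        _ ≤ |M.postMean (run δ F e n) (b c) c - M.postMean (run δ F e n) k c| ^ 2 := by gcongr
        _ = _ := sq_abs _
    have hfinal := counts_le_of_increments (N := fun n k => (run δ F e n).count (k, c))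
      (lt := lt) hlt hA1 hr0 (fun n hn => ?_)
    · refine ⟨L * r, fun n k => ?_⟩
      exact (count_run_mono δ F e (k, c) (le_max_left n N₀)).trans
        (hfinal (max n N₀) (le_max_right _ _) k)
    · by_cases hc : (δ n (run δ F e n)).2 = c
      · refine Or.inr ?_
        obtain ⟨b, k, hb, hkb, hmin, hcase⟩ := (hδ.step n hn (run δ F e n)).exists_count_le
          (hδ.pos.trans_le hn) ha (hpos n _) (hlow n _) (hup n _) hA1 (by linarith)
        rw [hc] at hkb hmin hcase
        have hkB : M.zeta (run δ F e n) b k c ≤ B := by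
          obtain ⟨k', hk', hle⟩ := hB n b
          exact (hmin k' c₀ hk').trans hle
        refine ⟨(δ n (run δ F e n)).1, fun i => ?_, ?_, ?_⟩
        · rw [count_run_succ]
          congr 2
          rw [Prod.ext_iff]
          simp [hc]
        · rcases hcase with ⟨hs, hi⟩ | ⟨hs, hi⟩
          · rw [hs]; exact hi
          · rw [hs]; exact ⟨b c, hkb.symm, hi k hkb⟩
        · rintro hsr ⟨i₀, hi₀⟩ hall i his hir
          have hwin : ∀ i, r ≤ (run δ F e n).count (i, c) →
              (run δ F e n).count (i, c) ∈ Finset.Icc r (L * r) := fun i hi =>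
            Finset.mem_Icc.2 ⟨hi, hall i⟩
          rcases hcase with ⟨hs, _⟩ | ⟨hs, hi⟩
          · rw [hs] at hsr his ⊢
            refine (htri i (b c) his).resolve_right fun h => ?_
            have := hmean n _ _ h (hwin _ hsr) (hwin _ hir)
            linarith [hb c i]
          · rw [hs] at hsr
            -- When the challenger is evaluated, every other count is at most `A` times that of the
            -- predicted best. A count of `A * r` thus puts the predicted best in the window too,
            -- and `ζ` would exceed `B`.
            have hbr : r ≤ (run δ F e n).count (b c, c) := by
              by_cases hib : i₀ = b c
              · rw [← hib]; exact (Nat.le_mul_of_pos_left _ hA1).trans hi₀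
              · exact Nat.le_of_mul_le_mul_left (hi₀.trans (hi i₀ hib)) hA1
            exact absurd hkB (not_le.2 (hzeta n b k hkb (hwin _ hsr) (hwin _ hbr)))
      · refine Or.inl fun k => ?_
        simp only [count_run_succ]
        rw [if_neg, add_zero]
        intro h
        exact hc (by rw [h])
  choose S hS using hbound
  -- After one step more than the sum of all bounds, the counts cannot add up to the number of
  -- steps.
  have h1 := sum_count_run δ F e (∑ p : K × C, S p.2 + 1)
  have h2 : ∑ p, (run δ F e (∑ p : K × C, S p.2 + 1)).count p ≤ ∑ p : K × C, S p.2 :=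
    Finset.sum_le_sum fun p _ => hS p.2 _ p.1
  omega

end Pathwise

end ContextualRS

/-! ### From the pathwise statement to almost sure convergence -/

theorem mainTheorem2
    {K C : Type*} [Fintype K] [DecidableEq K] [Nontrivial K]
    [Fintype C] [DecidableEq C] [Nonempty C]
    {Ω : Type*} [MeasurableSpace Ω] (P : Measure Ω) [IsProbabilityMeasure P]
    (M : ContextualRS.GPModel K C)
    (hnoise : ∀ k c, 0 < M.noiseVar k c)
    (hprior : ∀ k, (M.priorCov k).PosDef)
    (F : K → C → ℝ)
    (hbest : ∀ c, ∃! k, ∀ k', F k' c ≤ F k c)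
    (ε : ℕ → K → C → Ω → ℝ)
    (hlaw : ∀ j k c, HasLaw (ε j k c) (gaussianReal 0 (M.noiseVar k c)) P)
    (hindep : iIndepFun (fun q : ℕ × K × C => ε q.1 q.2.1 q.2.2) P)
    (N₀ : ℕ) (init : ℕ → K × C) (δ : ContextualRS.Policy K C)
    (hδ : ContextualRS.IsGPCOCBA M N₀ init δ) :
    ∀ᵐ ω ∂P, ∀ k c,
      Tendsto (fun n => (ContextualRS.run δ F (fun j k c => ε j k c ω) n).count (k, c))
        atTop atTop := by
  have haem : ∀ j k c, AEMeasurable (ε j k c) P := fun j k c => (hlaw j k c).aemeasurable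
  -- Measurable versions of the noise; the countably many exceptional null sets are discarded
  -- together.
  let X : ℕ → K × C → Ω → ℝ := fun j p => (haem j p.1 p.2).mk
  have hX : ∀ j p, ε j p.1 p.2 =ᵐ[P] X j p := fun j p => (haem j p.1 p.2).ae_eq_mk
  have hXm : ∀ j p, Measurable (X j p) := fun j p => (haem j p.1 p.2).measurable_mk
  have hXindep : iIndepFun (fun x : ℕ × K × C => X x.1 x.2) P :=
    hindep.congr fun x => hX x.1 x.2
  have hXlaw : ∀ j p, HasLaw (X j p) (gaussianReal 0 (M.noiseVar p.1 p.2)) P := fun j p =>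
    (hlaw j p.1 p.2).congr (hX j p).symm
  have hae : ∀ᵐ ω ∂P, ∀ j p, ε j p.1 p.2 ω = X j p ω := by
    rw [ae_all_iff]
    exact fun j => ae_all_iff.2 fun p => hX j p
  have hrank : Function.Injective fun k : K => (Fintype.equivFin K k : ℕ) :=
    Fin.val_injective.comp (Fintype.equivFin K).injective
  filter_upwards [hae, ContextualRS.ae_frequently_separated
    (fun p : K × C => hnoise p.1 p.2) hXm hXindep hXlaw
    (fun p => (Fintype.equivFin K p.1 : ℕ))] with ω hω hsep k c
  have hsum : ∀ (N : ℕ) (k : K) (c : C), ∑ i ∈ Finset.range N, ε i k c ω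
      = ∑ i ∈ Finset.range N, X i (k, c) ω := fun N k c =>
    Finset.sum_congr rfl fun i _ => hω i (k, c)
  refine ContextualRS.tendsto_count_run hnoise hprior F hδ hrank (fun k c => ?_)
    (fun L D hL => ?_) k c
  · simp only [hsum]
    exact hsep.1 (k, c)
  · refine (hsep.2 L D hL).mono fun r hr c i j hij N hN N' hN' => ?_
    rw [hsum, hsum]
    exact hr (i, c) (j, c) hij N hN N' hN'
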